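/- Identify $S^3$ with $\mathrm{SU}(2)$, fix a Haar measure on it, and let $\mathfrak h=L^2(S^3)\otimes\mathbb C^2$ be the Hilbert space of square-integrable functions $\psi\colon \mathrm{SU}(2)\to\mathbb C^2$. Let $\rho$ be the representation of $\mathrm{SU}(2)\times \mathrm{SU}(2)$ on $\mathfrak h$ given by $(\rho(g_1,g_2)\psi)(g)=g_2\,\psi(g_1^{-1}gg_2)$. Let $\sigma_1,\sigma_2,\sigma_3$ be the Pauli matrices, $(X_j\psi)(g)=\frac{d}{dt}\big|_{t=0}\psi(g\,e^{-it\sigma_j})$, and let $\mathbf d=\sum_{j=1}^3 i\sigma_jX_j+\frac32$ be the Dirac operator on $S^3$ in the left-invariant trivialization, with domain the set of all $\psi\in\mathfrak h$ whose distributional image $\mathbf d\psi$ lies in $\mathfrak h$. **Theorem.** $\rho$ is a strongly continuous unitary representation, $\mathbf d$ is self-adjoint with trivial kernel, and $\mathbf d$ commutes with $\rho$. Let $S=\mathbf d/|\mathbf d|$, that is, the operator that is $1$ on eigenvectors of $\mathbf d$ with positive eigenvalue and $-1$ on those with negative eigenvalue; it is unitary and self-adjoint, it commutes with $\mathbf d$,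 and $|\mathbf d|=S\mathbf d$ is a positive self-adjoint operator. Then $j=iS$ satisfies $j^2=-1$ and $j^*=-j$. Let $\mathcal H$ be the complex Hilbert space with the same underlying real vector space and the same norm as $\mathfrak h$ in which multiplication by the imaginary unit is $j$, and let $I\colon\mathfrak h\to\mathcal H$ be the identity map. The operators $\rho(g_1,g_2)$, $\mathbf d$ and $|\mathbf d|$ commute with $j$; hence they define a unitary representation $\rho_{\mathcal H}$ on $\mathcal H$ and operators on $\mathcal H$, of which $\mathbf d$ is self-adjoint and $|\mathbf d|$ is positive self-adjoint. Let $(C\psi)(g)=\epsilon\,\overline{\psi(g)}$ with $\epsilon=\begin{pmatrix}0&1\\-1&0\end{pmatrix}$, let $p_\pm$ be the orthogonal projections of $\mathfrak h$ onto the $\pm1$ eigenspaces of $S$, and let $$F=I(p_++Cp_-)\colon\ \mathfrak h\to\mathcal H .$$ Then $F$ is a complex-linear unitary operator from $\mathfrak h$ onto $\mathcal H$, and $F\rho(g_1,g_2)=\rho_{\mathcal H}(g_1,g_2)F$ for all $g_1,g_2\in \mathrm{SU}(2)$. A vector $\psi\in\mathfrak h$ lies in the domain of $\mathbf d$ if and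 only if $F\psi$ lies in the domain of $\mathbf d$ on $\mathcal H$, and then $F\mathbf d\psi=\mathbf dF\psi$. -/

import Mathlib

open MeasureTheory
open scoped ContDiff ComplexConjugate InnerProductSpace

noncomputable section

namespace SpinorSphere

/-! ### The group SU(2), identified with the 3-sphere -/

/-- The compact Lie group `SU(2)`, identified with `S³`. -/
abbrev SU2 : Type := Matrix.specialUnitaryGroup (Fin 2) ℂ

instance instMeasurableSpaceSU2 : MeasurableSpace SU2 := borel SU2

instance instBorelSpaceSU2 : BorelSpace SU2 := ⟨rfl⟩

instance instIsTopologicalGroupSU2 : IsTopologicalGroup SU2 where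
  continuous_inv := by
    refine Continuous.subtype_mk ?_ _
    exact continuous_subtype_val.star

instance instCompactSpaceSU2 : CompactSpace SU2 := by
  have hc : IsCompact (Set.univ.pi fun _ : Fin 2 => Set.univ.pi fun _ : Fin 2 =>
      Metric.closedBall (0 : ℂ) 1) :=
    isCompact_univ_pi fun _ => isCompact_univ_pi fun _ => isCompact_closedBall _ _
  refine isCompact_iff_compactSpace.mp (hc.of_isClosed_subset ?_ ?_)
  · have h1 : IsClosed {A : Matrix (Fin 2) (Fin 2) ℂ | star A * A = 1} :=
      isClosed_eq (continuous_star.mul continuous_id) continuous_const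
    have h2 : IsClosed {A : Matrix (Fin 2) (Fin 2) ℂ | A.det = 1} :=
      isClosed_eq continuous_id.matrix_det continuous_const
    have h3 : ((Matrix.specialUnitaryGroup (Fin 2) ℂ : Submonoid _) :
        Set (Matrix (Fin 2) (Fin 2) ℂ)) = {A | star A * A = 1} ∩ {A | A.det = 1} := by
      ext A
      simp [Matrix.mem_specialUnitaryGroup_iff, Matrix.mem_unitaryGroup_iff']
    exact h3 ▸ h1.inter h2
  · intro A hA i _ j _
    simpa using entry_norm_bound_of_unitary hA.1 i j

/-- The Pauli matrices `σ₁, σ₂, σ₃`. -/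
def pauli : Fin 3 → Matrix (Fin 2) (Fin 2) ℂ :=
  ![!![0, 1; 1, 0], !![0, -Complex.I; Complex.I, 0], !![1, 0; 0, -1]]

/-- The one-parameter subgroup `t ↦ exp (-i t σ_j) = cos t - i sin t σ_j` of `SU(2)`
(recall `σ_j² = 1`). -/
def expPauli (j : Fin 3) (t : ℝ) : SU2 :=
  ⟨(Real.cos t : ℂ) • (1 : Matrix (Fin 2) (Fin 2) ℂ)
      - (Complex.I * (Real.sin t : ℂ)) • pauli j, by
    have h : (Complex.cos t) ^ 2 + (Complex.sin t) ^ 2 = 1 := by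
      rw [add_comm]; exact Complex.sin_sq_add_cos_sq _
    have hI := Complex.I_sq
    have hc : conj (Complex.cos (t : ℂ)) = Complex.cos t := by
      rw [← Complex.cos_conj, Complex.conj_ofReal]
    have hs : conj (Complex.sin (t : ℂ)) = Complex.sin t := by
      rw [← Complex.sin_conj, Complex.conj_ofReal]
    rw [Matrix.mem_specialUnitaryGroup_iff, Matrix.mem_unitaryGroup_iff]
    constructor
    · ext a b
      fin_cases j <;> fin_cases a <;> fin_cases b <;>
        simp [pauli, Matrix.mul_apply, Fin.sum_univ_two, Matrix.star_apply, hc, hs] <;>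
        grind
    · fin_cases j <;> simp [pauli, Matrix.det_fin_two] <;> grind⟩

/-! ### Spinors -/

/-- The spin space `ℂ²` with its Hermitian norm. -/
abbrev Spin : Type := EuclideanSpace ℂ (Fin 2)

/-- A complex `2 × 2` matrix as a linear operator on `ℂ²`. -/
abbrev mat (A : Matrix (Fin 2) (Fin 2) ℂ) : Spin →L[ℂ] Spin :=
  Matrix.toEuclideanCLM (n := Fin 2) (𝕜 := ℂ) A

/-- The Hilbert space `L²(S³) ⊗ ℂ²` of square-integrable `ℂ²`-valued functions on `S³ ≅ SU(2)`,
with respect to the measure `μ`. -/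
abbrev SpinorL2 (μ : Measure SU2) : Type := Lp Spin 2 μ

/-! ### The representation `(ρ(g₁,g₂)ψ)(g) = g₂ ψ(g₁⁻¹ g g₂)` -/

lemma measurePreserving_action (μ : Measure SU2) [μ.IsHaarMeasure] (g : SU2 × SU2) :
    MeasurePreserving (fun h : SU2 => g.1⁻¹ * h * g.2) μ μ := by
  have hr : MeasurePreserving (fun h : SU2 => h * g.2) μ μ := by
    refine ⟨by fun_prop, ?_⟩
    have h1 := Measure.isMulInvariant_eq_smul_of_compactSpace (μ.map (· * g.2)) μ
    have h2 := congrArg (fun ν : Measure SU2 => ν Set.univ) h1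
    simp only [Measure.smul_apply] at h2
    rw [Measure.map_apply (by fun_prop) MeasurableSet.univ, Set.preimage_univ] at h2
    have hne : μ Set.univ ≠ 0 := (isOpen_univ.measure_pos μ Set.univ_nonempty).ne'
    have htop : μ Set.univ ≠ ⊤ := isCompact_univ.measure_lt_top.ne
    have h3 : (Measure.haarScalarFactor (μ.map (· * g.2)) μ : ENNReal) = 1 := by
      have : (Measure.haarScalarFactor (μ.map (· * g.2)) μ : ENNReal) * μ Set.univ
          = 1 * μ Set.univ := by
        rw [one_mul]; exact h2.symm
      exact (ENNReal.mul_left_inj hne htop).mp this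
    have h4 : Measure.haarScalarFactor (μ.map (· * g.2)) μ = 1 := by exact_mod_cast h3
    rw [h4, one_smul] at h1
    exact h1
  exact hr.comp (measurePreserving_mul_left μ g.1⁻¹)

lemma norm_mat_unitary (A : SU2) (v : Spin) : ‖mat A.1 v‖ = ‖v‖ := by
  have h1 : star A.1 * A.1 = 1 := A.2.1.1
  have h2 : star (mat A.1) * mat A.1 = 1 := by
    rw [mat, ← map_star, ← map_mul, h1, map_one]
  have h3 : (star (mat A.1)) (mat A.1 v) = v := by
    rw [← mul_apply_eq_comp, h2, one_apply_eq_self]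
  have h4 : ⟪mat A.1 v, mat A.1 v⟫_ℂ = ⟪v, v⟫_ℂ := by
    rw [← ContinuousLinearMap.adjoint_inner_right, ← ContinuousLinearMap.star_eq_adjoint, h3]
  rw [@norm_eq_sqrt_re_inner ℂ, @norm_eq_sqrt_re_inner ℂ, h4]

/-- The operator `ρ(g₁,g₂)`, `(ρ(g₁,g₂)ψ)(g) = g₂ ψ(g₁⁻¹ g g₂)`. -/
def rhoMap (μ : Measure SU2) [μ.IsHaarMeasure] (g : SU2 × SU2) :
    SpinorL2 μ →ₗ[ℂ] SpinorL2 μ :=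
  (mat g.2.1).compLpₗ 2 μ ∘ₗ
    Lp.compMeasurePreservingₗ ℂ (fun h : SU2 => g.1⁻¹ * h * g.2) (measurePreserving_action μ g)

lemma coeFn_rhoMap (μ : Measure SU2) [μ.IsHaarMeasure] (g : SU2 × SU2) (ψ : SpinorL2 μ) :
    rhoMap μ g ψ =ᵐ[μ] fun h => mat g.2.1 (ψ (g.1⁻¹ * h * g.2)) := by
  have h1 := (mat g.2.1).coeFn_compLp (Lp.compMeasurePreserving _ (measurePreserving_action μ g) ψ)
  have h2 := Lp.coeFn_compMeasurePreserving ψ (measurePreserving_action μ g)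
  filter_upwards [h1, h2] with x hx1 hx2
  refine hx1.trans ?_
  rw [hx2]
  rfl

lemma rhoMap_mul (μ : Measure SU2) [μ.IsHaarMeasure] (g k : SU2 × SU2) (ψ : SpinorL2 μ) :
    rhoMap μ (g * k) ψ = rhoMap μ g (rhoMap μ k ψ) := by
  refine Lp.ext ?_
  have h := (measurePreserving_action μ g).quasiMeasurePreserving.ae (coeFn_rhoMap μ k ψ)
  filter_upwards [coeFn_rhoMap μ (g * k) ψ, coeFn_rhoMap μ g (rhoMap μ k ψ), h]
    with x h1 h2 h3
  rw [h1, h2, h3]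
  simp [mul_assoc, map_mul]

lemma rhoMap_one (μ : Measure SU2) [μ.IsHaarMeasure] (ψ : SpinorL2 μ) :
    rhoMap μ 1 ψ = ψ := by
  refine Lp.ext ?_
  filter_upwards [coeFn_rhoMap μ 1 ψ] with x h1
  rw [h1]
  simp

lemma norm_rhoMap (μ : Measure SU2) [μ.IsHaarMeasure] (g : SU2 × SU2) (ψ : SpinorL2 μ) :
    ‖rhoMap μ g ψ‖ = ‖ψ‖ := by
  rw [← Lp.norm_compMeasurePreserving ψ (measurePreserving_action μ g), Lp.norm_def, Lp.norm_def]
  congr 1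
  refine eLpNorm_congr_norm_ae ?_
  filter_upwards [coeFn_rhoMap μ g ψ,
    Lp.coeFn_compMeasurePreserving ψ (measurePreserving_action μ g)] with x h1 h2
  rw [h1, h2, norm_mat_unitary]
  rfl

/-- The unitary representation `ρ` of `SU(2) × SU(2)` on `L²(S³) ⊗ ℂ²`. -/
def rho (μ : Measure SU2) [μ.IsHaarMeasure] :
    SU2 × SU2 →* (SpinorL2 μ ≃ₗᵢ[ℂ] SpinorL2 μ) where
  toFun g :=
    { toLinearEquiv := LinearEquiv.ofLinearMap (rhoMap μ g) (rhoMap μ g⁻¹)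
        (by ext1 ψ; simp [← rhoMap_mul, rhoMap_one])
        (by ext1 ψ; simp [← rhoMap_mul, rhoMap_one])
      norm_map' := norm_rhoMap μ g }
  map_one' := by ext1 ψ; exact rhoMap_one μ ψ
  map_mul' g k := by ext1 ψ; exact rhoMap_mul μ g k ψ

/-! ### The Dirac operator -/

/-- Smooth spinor fields on `S³`: as `SU(2)` is a compact submanifold of the space of complex
`2 × 2` matrices, these are the restrictions of smooth functions on that space. -/
def IsSmoothField (φ : SU2 → Spin) : Prop :=
  ∃ Φ : (Fin 2 → Fin 2 → ℂ) → Spin, ContDiff ℝ ∞ Φ ∧ ∀ g : SU2, φ g = Φ (fun a b => g.1 a b)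

/-- Differentiation by the unit left-invariant vector field `X_j`, which at the identity is
`-i σ_j`. -/
def leftInvDeriv (j : Fin 3) (φ : SU2 → Spin) (g : SU2) : Spin :=
  deriv (fun t : ℝ => φ (g * expPauli j t)) 0

/-- The Dirac differential operator `∑_j i σ_j X_j + 3/2` on smooth spinor fields. -/
def diracSmooth (φ : SU2 → Spin) (g : SU2) : Spin :=
  ∑ j, Complex.I • mat (pauli j) (leftInvDeriv j φ g) + (3 / 2 : ℂ) • φ g

/-- The graph of the distributional Dirac operator: `(ψ, η)` such that `η` is the Dirac operator
applied to `ψ` in the sense of distributions, that is, `⟪𝐝φ, ψ⟫ = ⟪φ, η⟫` in `L²` for every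
smooth spinor field `φ` (here `a` and `b` are the `L²` classes of `φ` and `𝐝φ`). -/
def diracGraph (μ : Measure SU2) : Submodule ℂ (SpinorL2 μ × SpinorL2 μ) where
  carrier := {p | ∀ (φ : SU2 → Spin) (a b : SpinorL2 μ), IsSmoothField φ → a =ᵐ[μ] φ →
    b =ᵐ[μ] diracSmooth φ → ⟪b, p.1⟫_ℂ = ⟪a, p.2⟫_ℂ}
  zero_mem' := by intro φ a b _ _ _; simp
  add_mem' := by
    intro p q hp hq φ a b h1 h2 h3
    simp [inner_add_right, hp φ a b h1 h2 h3, hq φ a b h1 h2 h3]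
  smul_mem' := by
    intro c p hp φ a b h1 h2 h3
    simp [inner_smul_right, hp φ a b h1 h2 h3]

/-- The Dirac operator `𝐝` as an unbounded operator on `L²(S³) ⊗ ℂ²`; its domain consists of all
`ψ` whose distributional image under the Dirac operator is in `L²(S³) ⊗ ℂ²`. -/
def dirac (μ : Measure SU2) : SpinorL2 μ →ₗ.[ℂ] SpinorL2 μ :=
  (diracGraph μ).toLinearPMap

/-! ### The sign of an operator with discrete spectrum -/

/-- The operator `T` preserves the domain of `A`, and `A T = T A` there. -/
def CommutesWith {E : Type*} [NormedAddCommGroup E] [InnerProductSpace ℂ E]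
    (T : E →L[ℂ] E) (A : E →ₗ.[ℂ] E) : Prop :=
  ∀ x : A.domain, ∃ h : T (x : E) ∈ A.domain, A ⟨T (x : E), h⟩ = T (A x)

section Spectral

variable {E : Type*} [NormedAddCommGroup E] [InnerProductSpace ℂ E] [CompleteSpace E]

/-- The closed span of all eigenvectors of `T` with eigenvalue in `s ⊆ ℝ`. -/
def spectralSubspace (T : E →ₗ.[ℂ] E) (s : Set ℝ) : Submodule ℂ E :=
  (Submodule.span ℂ {ψ : E | ∃ x : T.domain, (x : E) = ψ ∧
    ∃ r ∈ s, T x = (r : ℂ) • (x : E)}).topologicalClosure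

instance instCompleteSpectralSubspace (T : E →ₗ.[ℂ] E) (s : Set ℝ) :
    CompleteSpace (spectralSubspace T s) :=
  Submodule.topologicalClosure.completeSpace _

/-- `T / |T|`: it is `1` on eigenvectors of `T` with positive eigenvalue and `-1` on eigenvectors
with negative eigenvalue. -/
def signOp (T : E →ₗ.[ℂ] E) : E →L[ℂ] E :=
  (spectralSubspace T (Set.Ioi 0)).starProjection - (spectralSubspace T (Set.Iio 0)).starProjection

/-- The operator `|T| = (T / |T|) T`, with the domain of `T`. -/
def absOp (T : E →ₗ.[ℂ] E) : E →ₗ.[ℂ] E :=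
  (signOp T : E →ₗ[ℂ] E).compPMap T

/-- The orthogonal projection onto the eigenspace of the bounded operator `S` for the
eigenvalue `c`. -/
def eigenProjection (S : E →L[ℂ] E) (c : ℂ) : E →L[ℂ] E :=
  haveI : CompleteSpace (S - c • (1 : E →L[ℂ] E)).ker :=
    (S - c • (1 : E →L[ℂ] E)).isClosed_ker.completeSpace_coe
  (S - c • (1 : E →L[ℂ] E)).ker.starProjection

/-- `S` really is `T / |T|`: it is a self-adjoint unitary that commutes with `T`, and `S T` is a
(strictly) positive self-adjoint operator. -/
structure IsPolarSign (T : E →ₗ.[ℂ] E) (S : E →L[ℂ] E) : Prop where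
  isSelfAdjoint : IsSelfAdjoint S
  sq : S * S = 1
  commutes : CommutesWith S T
  abs_isSelfAdjoint : IsSelfAdjoint ((S : E →ₗ[ℂ] E).compPMap T)
  abs_pos : ∀ x : T.domain, (x : E) ≠ 0 → 0 < (⟪(x : E), S (T x)⟫_ℂ).re

end Spectral

/-! ### Changing the complex structure of a Hilbert space -/

section ComplexStructure

variable {E : Type*} [NormedAddCommGroup E] [InnerProductSpace ℂ E]

/-- A complex-linear operator `J` with `J² = -1` and `J* = -J`. -/
structure IsComplexStructure (J : E →L[ℂ] E) : Prop where
  sq : ∀ x, J (J x) = -x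
  skew : ∀ x y, ⟪J x, y⟫_ℂ = -⟪x, J y⟫_ℂ

namespace IsComplexStructure

variable {J : E →L[ℂ] E}

/-- `E` with the same addition and norm, in which `J` is the multiplication by the imaginary
unit. -/
def Space (_hJ : IsComplexStructure J) : Type _ := E

variable (hJ : IsComplexStructure J)

instance instNormedAddCommGroupSpace : NormedAddCommGroup hJ.Space :=
  inferInstanceAs (NormedAddCommGroup E)

instance instCompleteSpaceSpace [CompleteSpace E] : CompleteSpace hJ.Space := inferInstanceAs (CompleteSpace E)

/-- The identity map from `E` to `E` with the new complex structure. -/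
def I : E ≃+ hJ.Space := AddEquiv.refl E

instance instSMulSpace : SMul ℂ hJ.Space :=
  ⟨fun c x => hJ.I ((c.re : ℂ) • hJ.I.symm x + (c.im : ℂ) • J (hJ.I.symm x))⟩

lemma smul_def (c : ℂ) (x : hJ.Space) :
    c • x = hJ.I ((c.re : ℂ) • hJ.I.symm x + (c.im : ℂ) • J (hJ.I.symm x)) := rfl

lemma norm_I (x : E) : ‖hJ.I x‖ = ‖x‖ := rfl

instance instModuleSpace : Module ℂ hJ.Space where
  one_smul x := by simp [smul_def]
  mul_smul c d x := by
    simp only [smul_def, AddEquiv.symm_apply_apply, map_add, map_smul, hJ.sq]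
    simp only [← map_add]
    congr 1
    simp only [Complex.mul_re, Complex.mul_im, Complex.ofReal_sub, Complex.ofReal_add,
      Complex.ofReal_mul]
    module
  smul_zero c := by simp [smul_def]
  smul_add c x y := by
    simp only [smul_def, map_add, smul_add]
    abel
  add_smul c d x := by
    simp only [smul_def, ← map_add]
    congr 1
    simp only [Complex.add_re, Complex.add_im, Complex.ofReal_add]
    module
  zero_smul x := by simp [smul_def]

lemma re_inner_J_self (hJ : IsComplexStructure J) (x : E) : (⟪x, J x⟫_ℂ).re = 0 := by
  have h := congrArg Complex.re (hJ.skew x x)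
  have h2 : (⟪J x, x⟫_ℂ).re = (⟪x, J x⟫_ℂ).re := by
    rw [← inner_conj_symm, Complex.conj_re]
  rw [h2, Complex.neg_re] at h
  linarith

/-- The inner product whose norm is the given one and whose imaginary unit is `J`. -/
instance instInnerSpace : Inner ℂ hJ.Space :=
  ⟨fun x y => ⟨(⟪hJ.I.symm x, hJ.I.symm y⟫_ℂ).re, -(⟪hJ.I.symm x, J (hJ.I.symm y)⟫_ℂ).re⟩⟩

lemma inner_def (x y : hJ.Space) : ⟪x, y⟫_ℂ =
    ⟨(⟪hJ.I.symm x, hJ.I.symm y⟫_ℂ).re, -(⟪hJ.I.symm x, J (hJ.I.symm y)⟫_ℂ).re⟩ := rfl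

lemma norm_sq_eq (x : hJ.Space) : ‖x‖ ^ 2 = (⟪x, x⟫_ℂ).re :=
  norm_sq_eq_re_inner (𝕜 := ℂ) (hJ.I.symm x)

lemma space_smul_left (x y : hJ.Space) (c : ℂ) : ⟪c • x, y⟫_ℂ = conj c * ⟪x, y⟫_ℂ := by
  have e : ∀ a b : E, ⟪J a, J b⟫_ℂ = ⟪a, b⟫_ℂ := by
    intro a b
    rw [hJ.skew, hJ.sq, inner_neg_right, neg_neg]
  simp only [inner_def, smul_def, AddEquiv.symm_apply_apply, inner_add_left, inner_smul_left,
    e, hJ.skew]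
  apply Complex.ext <;> simp <;> ring

instance instNormedSpaceSpace : NormedSpace ℂ hJ.Space where
  norm_smul_le c x := by
    have h : ‖c • x‖ ^ 2 = (‖c‖ * ‖x‖) ^ 2 := by
      have h1 : ⟪x, c • x⟫_ℂ = c * ⟪x, x⟫_ℂ := by
        simp only [inner_def, smul_def, AddEquiv.symm_apply_apply, map_add, map_smul, hJ.sq,
          inner_add_right, inner_smul_right, inner_neg_right]
        apply Complex.ext <;> simp [hJ.re_inner_J_self]
      have h0 : (⟪x, x⟫_ℂ).im = 0 := by simp [inner_def, hJ.re_inner_J_self]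
      rw [norm_sq_eq, space_smul_left, h1, mul_pow, norm_sq_eq, ← mul_assoc, Complex.mul_re, h0,
        ← Complex.normSq_eq_norm_sq, mul_comm (conj c) c, Complex.mul_conj]
      simp
    exact le_of_eq ((sq_eq_sq₀ (norm_nonneg _) (by positivity)).mp h)

instance instInnerProductSpaceSpace : InnerProductSpace ℂ hJ.Space where
  norm_sq_eq_re_inner x := norm_sq_eq hJ x
  conj_inner_symm x y := by
    apply Complex.ext
    · simp only [inner_def, Complex.conj_re]
      rw [← inner_conj_symm, Complex.conj_re]
    · simp only [inner_def, Complex.conj_im, neg_neg]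
      rw [← inner_conj_symm, Complex.conj_re, hJ.skew, Complex.neg_re]
  add_left x y z := by
    apply Complex.ext <;> simp [inner_def]
    ring
  smul_left x y c := space_smul_left hJ x y c

/-- An operator on `E` that commutes with `J`, as an operator for the new complex structure, with
the same domain and the same values. -/
def op (A : E →ₗ.[ℂ] E) (hA : CommutesWith J A) : hJ.Space →ₗ.[ℂ] hJ.Space where
  domain :=
    { carrier := {x | hJ.I.symm x ∈ A.domain}
      zero_mem' := by simp
      add_mem' := by
        intro x y hx hy
        rw [Set.mem_ofPred_eq, map_add]
        exact add_mem (S := Submodule ℂ E) hx hy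
      smul_mem' := by
        intro c x hx
        obtain ⟨h, -⟩ := hA ⟨hJ.I.symm x, hx⟩
        rw [Set.mem_ofPred_eq, smul_def, AddEquiv.symm_apply_apply]
        exact add_mem (S := Submodule ℂ E) (A.domain.smul_mem _ hx) (A.domain.smul_mem _ h) }
  toFun :=
    { toFun := fun x => hJ.I (A ⟨hJ.I.symm x, x.2⟩)
      map_add' := by
        intro x y
        rw [← map_add, ← A.map_add]
        rfl
      map_smul' := by
        intro c x
        obtain ⟨h, h'⟩ := hA ⟨hJ.I.symm x, x.2⟩
        rw [RingHom.id_apply, smul_def, AddEquiv.symm_apply_apply, ← h', ← A.map_smul,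
          ← A.map_smul, ← A.map_add]
        rfl }

/-- A unitary representation on `E` that commutes with `J`, as a unitary representation for the
new complex structure, given by the same operators. -/
def rep {G : Type*} [Group G] (π : G →* (E ≃ₗᵢ[ℂ] E)) (hπ : ∀ g x, π g (J x) = J (π g x)) :
    G →* (hJ.Space ≃ₗᵢ[ℂ] hJ.Space) where
  toFun g :=
    { toFun := fun x => hJ.I (π g (hJ.I.symm x))
      invFun := fun x => hJ.I ((π g).symm (hJ.I.symm x))
      left_inv := fun x => by simp
      right_inv := fun x => by simp
      map_add' := fun x y => by simp
      map_smul' := fun c x => by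
        simp only [smul_def, AddEquiv.symm_apply_apply, map_add, map_smul, hπ, RingHom.id_apply]
      norm_map' := fun x => (π g).norm_map _ }
  map_one' := by
    ext1 x
    change hJ.I (π 1 (hJ.I.symm x)) = x
    simp
  map_mul' g h := by
    ext1 x
    change hJ.I (π (g * h) (hJ.I.symm x)) = hJ.I (π g (hJ.I.symm (hJ.I (π h (hJ.I.symm x)))))
    simp

end IsComplexStructure

end ComplexStructure

/-! ### The new complex structure and the map `F` -/

/-- The new complex structure `j = i 𝐝/|𝐝|`. -/
def newJ (μ : Measure SU2) : SpinorL2 μ →L[ℂ] SpinorL2 μ :=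
  Complex.I • signOp (dirac μ)

/-- Componentwise complex conjugation on `ℂ²`. -/
def conjSpin : Spin →L⋆[ℂ] Spin :=
  LinearMap.mkContinuous
    { toFun := fun v => WithLp.toLp 2 fun k => conj (v k)
      map_add' := fun v w => by ext k; simp
      map_smul' := fun c v => by ext k; simp } 1
    (fun v => by simp [EuclideanSpace.norm_eq])

/-- The charge conjugation `(C ψ)(g) = ε ψ̄(g)` with `ε = (0 1; -1 0)`. -/
def chargeConj (μ : Measure SU2) : SpinorL2 μ →L⋆[ℂ] SpinorL2 μ :=
  ((mat !![0, 1; -1, 0]).comp conjSpin).compLpL 2 μ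

/-- The map `F = I (p₊ + C p₋)`, where `p₊` and `p₋` are the orthogonal projections onto the
eigenspaces of `𝐝/|𝐝|` for the eigenvalues `1` and `-1`, and `I` is the identity map to the
Hilbert space with the new complex structure. -/
def mapF (μ : Measure SU2) (hJ : IsComplexStructure (newJ μ)) (ψ : SpinorL2 μ) : hJ.Space :=
  hJ.I (eigenProjection (signOp (dirac μ)) 1 ψ +
    chargeConj μ (eigenProjection (signOp (dirac μ)) (-1) ψ))

end SpinorSphere

end

open SpinorSphere

/-! The spinor fields whose components are polynomials of degree at most `n` in the matrix entries
form finite-dimensional spaces. They are invariant under 𝐝, because each `X_j` is a derivation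
sending entries to linear combinations of entries. Their union is dense by Stone–Weierstrass, and 𝐝
is symmetric on smooth fields since derivatives along `X_j` integrate to zero for Haar measure.
Orthogonal projection onto these spaces therefore turns a distributional solution `𝐝ψ = η` into
polynomial solutions converging to it in the graph norm. Hence the maximal operator is the closure
of its polynomial restriction and is self-adjoint. `IsExhaustedBy` axiomatizes this situation and
`isExhaustedBy_dirac` verifies it.

The spectral gap comes from `polySpin_polySpin`: for `T = 𝐝 - 3/2` one has `(T + 1)² = 1 - ∑ X_j² ≥
1`, so `(r - 1/2)² ≥ 1` for every eigenvalue `r` and thus `|r| ≥ 1/2`. Consequently the positive and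
negative spectral subspaces span everything, `S² = 1`, and `⟪ψ, S𝐝ψ⟫ ≥ ‖ψ‖²/2`, which gives the
trivial kernel and the positivity of |𝐝|.

Charge conjugation `C` is antiunitary with `C² = -1`. It commutes with `SU(2)` and with each `iσ_j`,
hence with ρ, 𝐝 and `S`. On the range of `p₋` the new unit `j = iS` is `-i`, which is what the
antilinear `C` makes of `i`; so `p₊ + C p₋` is linear into the new structure, with inverse `p₊ - C
p₋`. Everything commuting with `C` and `S` passes through it (`exists_unitary`). -/

namespace SpinorSphere

/-! ### Unbounded operators through their graphs -/

section Graph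

variable {E : Type*} [NormedAddCommGroup E] [InnerProductSpace ℂ E]

lemma mem_graph_of_mem_domain (A : E →ₗ.[ℂ] E) {x : E} (hx : x ∈ A.domain) :
    (x, A ⟨x, hx⟩) ∈ A.graph := A.mem_graph ⟨x, hx⟩

lemma graph_right_unique (A : E →ₗ.[ℂ] E) {x y z : E} (h : (x, y) ∈ A.graph)
    (h' : (x, z) ∈ A.graph) : y = z :=
  A.mem_graph_snd_inj h h' rfl

/-- Invariance of the graph under `T × T` avoids dependent domain proofs; the commutation arguments
below take this form. -/
lemma commutesWith_iff_graph (T : E →L[ℂ] E) (A : E →ₗ.[ℂ] E) :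
    CommutesWith T A ↔ ∀ x y, (x, y) ∈ A.graph → (T x, T y) ∈ A.graph := by
  constructor
  · intro h x y hxy
    obtain ⟨z, rfl, rfl⟩ := A.mem_graph_iff.mp hxy
    obtain ⟨h1, h2⟩ := h z
    rw [← h2]
    exact A.mem_graph ⟨T z, h1⟩
  · intro h x
    obtain ⟨z, hz1, hz2⟩ := A.mem_graph_iff.mp (h x (A x) (A.mem_graph x))
    refine ⟨(show (z : E) = T x from hz1) ▸ z.2, ?_⟩
    refine Eq.trans ?_ hz2
    congr 1
    exact Subtype.ext hz1.symm

lemma mem_graph_compPMap (S : E →L[ℂ] E) (A : E →ₗ.[ℂ] E) (x y : E) :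
    (x, y) ∈ ((S : E →ₗ[ℂ] E).compPMap A).graph ↔ ∃ z, (x, z) ∈ A.graph ∧ S z = y := by
  simp only [LinearPMap.mem_graph_iff]
  constructor
  · rintro ⟨z, h1, h2⟩
    exact ⟨A z, ⟨z, h1, rfl⟩, h2⟩
  · rintro ⟨_, ⟨z, h1, rfl⟩, h2⟩
    exact ⟨z, h1, h2⟩

variable [CompleteSpace E]

lemma mem_graph_iff_of_isSelfAdjoint {A : E →ₗ.[ℂ] E} (hA : IsSelfAdjoint A) (x y : E) :
    (x, y) ∈ A.graph ↔ ∀ a b, (a, b) ∈ A.graph → ⟪b, x⟫_ℂ = ⟪a, y⟫_ℂ := by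
  have h := LinearPMap.adjoint_graph_eq_graph_adjoint hA.dense_domain
  rw [LinearPMap.isSelfAdjoint_def.mp hA] at h
  conv_lhs => rw [h]
  simp only [Submodule.mem_adjoint_iff, sub_eq_zero]

lemma isSelfAdjoint_of_mem_graph_iff {A : E →ₗ.[ℂ] E} (hd : Dense (A.domain : Set E))
    (h : ∀ x y, (x, y) ∈ A.graph ↔ ∀ a b, (a, b) ∈ A.graph → ⟪b, x⟫_ℂ = ⟪a, y⟫_ℂ) :
    IsSelfAdjoint A := by
  rw [LinearPMap.isSelfAdjoint_def]
  apply LinearPMap.eq_of_eq_graph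
  rw [LinearPMap.adjoint_graph_eq_graph_adjoint hd]
  ext ⟨x, y⟩
  rw [h]
  simp only [Submodule.mem_adjoint_iff, sub_eq_zero]

lemma inner_apply_right_of_isSelfAdjoint {S : E →L[ℂ] E} (hS : IsSelfAdjoint S) (x y : E) :
    ⟪x, S y⟫_ℂ = ⟪S x, y⟫_ℂ :=
  (hS.isSymmetric x y).symm

/-- Composing a self-adjoint operator with a commuting self-adjoint involution gives a
self-adjoint operator. -/
lemma isSelfAdjoint_compPMap {A : E →ₗ.[ℂ] E} (hA : IsSelfAdjoint A) {S : E →L[ℂ] E}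
    (hS : IsSelfAdjoint S) (hsq : ∀ x, S (S x) = x)
    (hc : ∀ x y, (x, y) ∈ A.graph → (S x, S y) ∈ A.graph) :
    IsSelfAdjoint ((S : E →ₗ[ℂ] E).compPMap A) := by
  apply isSelfAdjoint_of_mem_graph_iff
  · exact hA.dense_domain
  intro x y
  rw [mem_graph_compPMap]
  constructor
  · rintro ⟨z, hz, rfl⟩ a b hab
    obtain ⟨b, hb, rfl⟩ := (mem_graph_compPMap _ _ _ _).mp hab
    rw [← inner_apply_right_of_isSelfAdjoint hS]
    exact (mem_graph_iff_of_isSelfAdjoint hA _ _).mp (hc _ _ hz) _ _ hb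
  · intro h
    refine ⟨S y, ?_, hsq y⟩
    -- Testing against `(a, S b)` and moving `S` across shows that `S x` solves the weak equation
    -- for `A`; applying `S` once more gives the claim.
    have h1 : (S x, y) ∈ A.graph := by
      rw [mem_graph_iff_of_isSelfAdjoint hA]
      intro a b hab
      rw [inner_apply_right_of_isSelfAdjoint hS]
      exact h _ _ ((mem_graph_compPMap _ _ _ _).mpr ⟨b, hab, rfl⟩)
    simpa [hsq] using hc _ _ h1

end Graph

/-! ### Operators exhausted by finite-dimensional invariant subspaces -/

section Exhaustion

variable {E : Type*} [NormedAddCommGroup E] [InnerProductSpace ℂ E]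

/-- The operator `A` is the maximal extension of a symmetric operator defined on an increasing
sequence of finite-dimensional invariant subspaces with dense union, and `c` is a lower bound for
the absolute values of the eigenvalues there. -/
structure IsExhaustedBy (A : E →ₗ.[ℂ] E) (W : ℕ → Submodule ℂ E) (c : ℝ) : Prop where
  mono : Monotone W
  finite : ∀ n, FiniteDimensional ℂ (W n)
  dense : (⨆ n, W n).topologicalClosure = ⊤
  maps : ∀ n, ∀ w ∈ W n, ∃ v ∈ W n, (w, v) ∈ A.graph
  closed : A.IsClosed
  symm : ∀ x y, (x, y) ∈ A.graph →
    ∀ n w v, w ∈ W n → (w, v) ∈ A.graph → ⟪v, x⟫_ℂ = ⟪w, y⟫_ℂ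
  gap_pos : 0 < c
  gap : ∀ n w (r : ℝ), w ∈ W n → (w, (r : ℂ) • w) ∈ A.graph → w ≠ 0 → c ≤ |r|

namespace IsExhaustedBy

variable {A : E →ₗ.[ℂ] E} {W : ℕ → Submodule ℂ E} {c : ℝ} (h : IsExhaustedBy A W c)
include h

lemma le_domain (n : ℕ) : W n ≤ A.domain := by
  intro w hw
  obtain ⟨v, -, hv⟩ := h.maps n w hw
  exact LinearPMap.mem_domain_of_mem_graph hv

lemma apply_mem (n : ℕ) (w : W n) : A ⟨w, h.le_domain n w.2⟩ ∈ W n := by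
  obtain ⟨v, hv, hg⟩ := h.maps n w w.2
  rwa [graph_right_unique A (mem_graph_of_mem_domain A (h.le_domain n w.2)) hg]

lemma dense_domain : Dense (A.domain : Set E) := by
  rw [Submodule.dense_iff_topologicalClosure_eq_top, eq_top_iff, ← h.dense]
  exact Submodule.topologicalClosure_mono (iSup_le h.le_domain)

omit h in
/-- The restriction of the operator to one of the invariant subspaces. -/
noncomputable def restr (h : IsExhaustedBy A W c) (n : ℕ) : W n →ₗ[ℂ] W n :=
  LinearMap.codRestrict (W n) (A.toFun ∘ₗ Submodule.inclusion (h.le_domain n)) (h.apply_mem n)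

lemma mem_graph_restr (n : ℕ) (w : W n) : ((w : E), (h.restr n w : E)) ∈ A.graph :=
  mem_graph_of_mem_domain A (h.le_domain n w.2)

lemma coe_restr_eq (n : ℕ) (w : W n) {v : E} (hv : ((w : E), v) ∈ A.graph) :
    (h.restr n w : E) = v :=
  graph_right_unique A (h.mem_graph_restr n w) hv

lemma isSymmetric_restr (n : ℕ) : (h.restr n).IsSymmetric := fun v w =>
  h.symm _ _ (h.mem_graph_restr n w) n v _ v.2 (h.mem_graph_restr n v)

/-- A subspace of `W n` is everything as soon as it contains all eigenvectors. -/
lemma eigen_induction (n : ℕ) (K : Submodule ℂ (W n))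
    (hK : ∀ (e : W n) (r : ℝ), ((e : E), (r : ℂ) • (e : E)) ∈ A.graph → e ≠ 0 → e ∈ K)
    (w : W n) : w ∈ K := by
  have := h.finite n
  have hs := h.isSymmetric_restr n
  have htop : ⨆ μ, Module.End.eigenspace (h.restr n) μ = ⊤ :=
    Submodule.orthogonal_eq_bot_iff.mp hs.orthogonalComplement_iSup_eigenspaces_eq_bot
  suffices ⨆ μ, Module.End.eigenspace (h.restr n) μ ≤ K from this (htop ▸ Submodule.mem_top)
  refine iSup_le fun μ e he => ?_
  by_cases h0 : e = 0
  · rw [h0]; exact K.zero_mem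
  have hr : conj μ = μ :=
    hs.conj_eigenvalue_eq_self (Module.End.hasEigenvalue_of_hasEigenvector ⟨he, h0⟩)
  have hμ : ((μ.re : ℝ) : ℂ) = μ := Complex.conj_eq_iff_re.mp hr
  refine hK e μ.re ?_ h0
  have := h.mem_graph_restr n e
  rw [Module.End.mem_eigenspace_iff.mp he] at this
  rwa [hμ]

variable [CompleteSpace E]

omit [CompleteSpace E] in
-- With `P` the projection and `w ∈ W n`, invariance and symmetry give `⟪A P x, w⟫ = ⟪P x, A w⟫ =
-- ⟪x, A w⟫ = ⟪y, w⟫`, so `A P x = P y`.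
lemma projection_mem_graph (n : ℕ) [FiniteDimensional ℂ (W n)] {x y : E}
    (hxy : ∀ n w v, w ∈ W n → (w, v) ∈ A.graph → ⟪v, x⟫_ℂ = ⟪w, y⟫_ℂ) :
    ((W n).starProjection x, (W n).starProjection y) ∈ A.graph := by
  have hx : (W n).starProjection x ∈ W n := Submodule.starProjection_apply_mem _ _
  have hg := h.mem_graph_restr n ⟨_, hx⟩
  have key : (h.restr n ⟨_, hx⟩ : E) = (W n).starProjection y := by
    symm
    apply Submodule.eq_starProjection_of_mem_of_inner_eq_zero
    · exact Subtype.coe_prop _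
    intro w hw
    rw [inner_sub_left, sub_eq_zero, ← inner_conj_symm, ← inner_conj_symm _ w]
    congr 1
    rw [← h.symm _ _ hg n w _ hw (h.mem_graph_restr n ⟨w, hw⟩),
      ← hxy n w _ hw (h.mem_graph_restr n ⟨w, hw⟩)]
    rw [← Submodule.inner_starProjection_left_eq_right,
      Submodule.starProjection_eq_self_iff.mpr (Subtype.coe_prop _)]
  rwa [← key]

omit [CompleteSpace E] in
open Filter Topology in
-- Density of the union makes the projections converge strongly to the identity, so a weak solution
-- is a graph limit of solutions inside the `W n`.
lemma exists_approx {x y : E}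
    (hxy : ∀ n w v, w ∈ W n → (w, v) ∈ A.graph → ⟪v, x⟫_ℂ = ⟪w, y⟫_ℂ) :
    ∃ u v : ℕ → E, (∀ n, u n ∈ W n ∧ (u n, v n) ∈ A.graph) ∧
      Tendsto u atTop (𝓝 x) ∧ Tendsto v atTop (𝓝 y) := by
  have := h.finite
  exact ⟨fun n => (W n).starProjection x, fun n => (W n).starProjection y,
    fun n => ⟨Submodule.starProjection_apply_mem _ _, h.projection_mem_graph n hxy⟩,
    Submodule.starProjection_tendsto_self W h.mono x (by rw [h.dense]),
    Submodule.starProjection_tendsto_self W h.mono y (by rw [h.dense])⟩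

omit [CompleteSpace E] in
lemma weak (x y : E) : (x, y) ∈ A.graph ↔
    ∀ n w v, w ∈ W n → (w, v) ∈ A.graph → ⟪v, x⟫_ℂ = ⟪w, y⟫_ℂ := by
  refine ⟨h.symm x y, fun hxy => ?_⟩
  obtain ⟨u, v, huv, hu, hv⟩ := h.exists_approx hxy
  exact h.closed.mem_of_tendsto (hu.prodMk_nhds hv) (.of_forall fun n => (huv n).2)

omit [CompleteSpace E] in
-- Only `(a, b)` needs approximating: symmetry against pairs in `W n` is already available.
lemma graph_symm {x y a b : E} (hxy : (x, y) ∈ A.graph) (hab : (a, b) ∈ A.graph) :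
    ⟪b, x⟫_ℂ = ⟪a, y⟫_ℂ := by
  obtain ⟨u, v, huv, hu, hv⟩ := h.exists_approx (h.symm _ _ hab)
  refine tendsto_nhds_unique (hv.inner tendsto_const_nhds)
    ((hu.inner tendsto_const_nhds).congr fun n => ?_)
  exact ((h.weak _ _).mp hxy n _ _ (huv n).1 (huv n).2).symm

theorem isSelfAdjoint : IsSelfAdjoint A := by
  refine isSelfAdjoint_of_mem_graph_iff h.dense_domain fun x y => ⟨fun hxy a b hab =>
    h.graph_symm hxy hab, fun hxy => (h.weak x y).mpr fun n w v _ hwv => hxy w v hwv⟩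

/-! ### The sign -/

omit h [CompleteSpace E] in
lemma mem_spectralSubspace [CompleteSpace E] {s : Set ℝ} {e : E} {r : ℝ} (hr : r ∈ s)
    (he : (e, (r : ℂ) • e) ∈ A.graph) : e ∈ spectralSubspace A s := by
  obtain ⟨x, hx, hx'⟩ := A.mem_graph_iff.mp he
  exact Submodule.le_topologicalClosure _ (Submodule.subset_span ⟨x, hx, r, hr, by rw [hx', hx]⟩)

omit [CompleteSpace E] in
-- The gap excludes the eigenvalue zero, on which the sign would vanish.
lemma exists_sign (n : ℕ) {e : E} {r : ℝ} (hn : e ∈ W n) (he : (e, (r : ℂ) • e) ∈ A.graph)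
    (h0 : e ≠ 0) : 0 < r ∨ r < 0 := by
  have h1 := h.gap n e r hn he h0
  have h2 : r ≠ 0 := abs_pos.mp (h.gap_pos.trans_le h1)
  exact h2.symm.lt_or_gt

omit [CompleteSpace E] in
-- Symmetry gives `(r - s)⟪x, y⟫ = 0` for eigenvectors with `r > 0 > s`; orthogonality survives
-- closed spans.
lemma spectralSubspace_isOrtho :
    spectralSubspace A (Set.Ioi 0) ⟂ spectralSubspace A (Set.Iio 0) := by
  unfold spectralSubspace
  rw [Submodule.isOrtho_iff_le]
  apply Submodule.topologicalClosure_minimal _ _ (Submodule.isClosed_orthogonal _)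
  rw [Submodule.orthogonal_closure, ← Submodule.isOrtho_iff_le, Submodule.isOrtho_span]
  rintro _ ⟨x, rfl, r, hr, hx⟩ _ ⟨y, rfl, s, hs, hy⟩
  have h1 := h.graph_symm (A.mem_graph y) (A.mem_graph x)
  rw [hx, hy, inner_smul_left, inner_smul_right, Complex.conj_ofReal, ← sub_eq_zero,
    ← sub_mul] at h1
  refine (mul_eq_zero.mp h1).resolve_left ?_
  rw [← Complex.ofReal_sub]
  have : (0 : ℝ) < r - s := by
    have := Set.mem_Ioi.mp hr
    have := Set.mem_Iio.mp hs
    linarith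
  exact_mod_cast this.ne'

lemma le_spectralSubspace_sup (n : ℕ) :
    W n ≤ spectralSubspace A (Set.Ioi 0) ⊔ spectralSubspace A (Set.Iio 0) := by
  intro w hw
  refine h.eigen_induction n (Submodule.comap (W n).subtype
    (spectralSubspace A (Set.Ioi 0) ⊔ spectralSubspace A (Set.Iio 0))) ?_ ⟨w, hw⟩
  intro e r her h0
  rcases h.exists_sign n e.2 her (by simpa using h0) with hr | hr
  · exact Submodule.mem_sup_left (mem_spectralSubspace hr her)
  · exact Submodule.mem_sup_right (mem_spectralSubspace hr her)

/-- The remainder is orthogonal to both subspaces, whose sum contains every `W n` and is therefore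
dense. -/
lemma starProjection_add (x : E) : (spectralSubspace A (Set.Ioi 0)).starProjection x +
    (spectralSubspace A (Set.Iio 0)).starProjection x = x := by
  set P := spectralSubspace A (Set.Ioi 0)
  set N := spectralSubspace A (Set.Iio 0)
  have hPN : P ⟂ N := h.spectralSubspace_isOrtho
  have hbot : (P ⊔ N)ᗮ = ⊥ := by
    rw [eq_bot_iff, ← Submodule.top_orthogonal_eq_bot, ← h.dense, Submodule.orthogonal_closure]
    exact Submodule.orthogonal_le (iSup_le h.le_spectralSubspace_sup)
  have h1 : x - (P.starProjection x + N.starProjection x) ∈ (P ⊔ N)ᗮ := by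
    rw [← Submodule.inf_orthogonal]
    constructor
    · rw [← sub_sub]
      refine sub_mem (Submodule.sub_starProjection_mem_orthogonal x) ?_
      exact hPN.symm.le (Submodule.starProjection_apply_mem _ _)
    · rw [add_comm, ← sub_sub]
      refine sub_mem (Submodule.sub_starProjection_mem_orthogonal x) ?_
      exact hPN.le (Submodule.starProjection_apply_mem _ _)
  rw [hbot, Submodule.mem_bot, sub_eq_zero] at h1
  exact h1.symm

lemma signOp_of_pos {x : E} (hx : x ∈ spectralSubspace A (Set.Ioi 0)) : signOp A x = x := by
  rw [signOp, sub_apply, Submodule.starProjection_eq_self_iff.mpr hx,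
    (Submodule.starProjection_apply_eq_zero_iff _).mpr (h.spectralSubspace_isOrtho.le hx), sub_zero]

lemma signOp_of_neg {x : E} (hx : x ∈ spectralSubspace A (Set.Iio 0)) : signOp A x = -x := by
  rw [signOp, sub_apply, Submodule.starProjection_eq_self_iff.mpr hx,
    (Submodule.starProjection_apply_eq_zero_iff _).mpr (h.spectralSubspace_isOrtho.symm.le hx),
    zero_sub]

lemma exists_decomp (x : E) : ∃ p ∈ spectralSubspace A (Set.Ioi 0),
    ∃ q ∈ spectralSubspace A (Set.Iio 0), x = p + q :=
  ⟨_, Submodule.starProjection_apply_mem _ _, _, Submodule.starProjection_apply_mem _ _,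
    (h.starProjection_add x).symm⟩

lemma signOp_signOp (x : E) : signOp A (signOp A x) = x := by
  obtain ⟨p, hp, q, hq, rfl⟩ := h.exists_decomp x
  simp [h.signOp_of_pos hp, h.signOp_of_neg hq]

omit h in
lemma isSelfAdjoint_signOp (A : E →ₗ.[ℂ] E) : IsSelfAdjoint (signOp A) :=
  (isSelfAdjoint_starProjection _).sub (isSelfAdjoint_starProjection _)

/-- An additive continuous map that preserves the eigenvectors commutes with the sign. -/
lemma signOp_comm (T : E →+ E) (hT : Continuous T)
    (hsmul : ∀ (c : ℂ) x, ∃ d : ℂ, T (c • x) = d • T x)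
    (hreal : ∀ (r : ℝ) x, T ((r : ℂ) • x) = (r : ℂ) • T x)
    (hg : ∀ x y, (x, y) ∈ A.graph → (T x, T y) ∈ A.graph) (x : E) :
    signOp A (T x) = T (signOp A x) := by
  have hs : ∀ s : Set ℝ, ∀ x ∈ spectralSubspace A s, T x ∈ spectralSubspace A s := by
    intro s x hx
    -- Since `s` is real, even an antilinear `T` sends an eigenvector to one with the same
    -- eigenvalue; `hsmul` then handles spans and continuity handles closures.
    have hcl : IsClosed (spectralSubspace A s : Set E) := Submodule.isClosed_topologicalClosure _
    have hmaps : Set.MapsTo T (Submodule.span ℂ {ψ : E | ∃ x : A.domain, (x : E) = ψ ∧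
        ∃ r ∈ s, A x = (r : ℂ) • (x : E)} : Set E) (spectralSubspace A s) := by
      intro y hy
      induction hy using Submodule.span_induction with
      | mem y hy =>
        obtain ⟨x, rfl, r, hr, hx⟩ := hy
        refine mem_spectralSubspace hr ?_
        rw [← hreal, ← hx]
        exact hg _ _ (A.mem_graph x)
      | zero => simp
      | add y z _ _ h1 h2 => rw [map_add]; exact add_mem h1 h2
      | smul c y _ h1 =>
        obtain ⟨d, hd⟩ := hsmul c y
        rw [hd]
        exact Submodule.smul_mem _ _ h1
    have := hmaps.closure hT hx
    rwa [hcl.closure_eq] at this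
  obtain ⟨p, hp, q, hq, rfl⟩ := h.exists_decomp x
  simp [h.signOp_of_pos hp, h.signOp_of_neg hq, h.signOp_of_pos (hs _ _ hp),
    h.signOp_of_neg (hs _ _ hq)]

/-- Encoding the sign as a scalar with `s * r = |r|` lets later arguments avoid splitting into
cases. -/
lemma signOp_eigenvector (n : ℕ) {e : E} {r : ℝ} (hn : e ∈ W n)
    (he : (e, (r : ℂ) • e) ∈ A.graph) (h0 : e ≠ 0) :
    ∃ s : ℝ, signOp A e = (s : ℂ) • e ∧ s * r = |r| := by
  rcases h.exists_sign n hn he h0 with hr | hr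
  · exact ⟨1, by simp [h.signOp_of_pos (mem_spectralSubspace hr he)], by
      rw [abs_of_pos hr, one_mul]⟩
  · exact ⟨-1, by simp [h.signOp_of_neg (mem_spectralSubspace hr he)], by
      rw [abs_of_neg hr]; ring⟩

/-- By `weak` it suffices to test against `W n`. Moving the self-adjoint sign onto the test pair
reduces the claim to `W n`, where it is checked on eigenvectors. -/
lemma signOp_graph {x y : E} (hxy : (x, y) ∈ A.graph) :
    (signOp A x, signOp A y) ∈ A.graph := by
  rw [h.weak]
  intro n w v hw hwv
  rw [inner_apply_right_of_isSelfAdjoint (isSelfAdjoint_signOp A),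
    inner_apply_right_of_isSelfAdjoint (isSelfAdjoint_signOp A)]
  refine h.graph_symm hxy ?_
  let L : W n →ₗ[ℂ] E × E := ((signOp A : E →ₗ[ℂ] E) ∘ₗ (W n).subtype).prod
    ((signOp A : E →ₗ[ℂ] E) ∘ₗ (W n).subtype ∘ₗ h.restr n)
  have key := h.eigen_induction n (A.graph.comap L) ?_ ⟨w, hw⟩
  · have := h.coe_restr_eq n ⟨w, hw⟩ hwv
    rw [Submodule.mem_comap] at key
    rwa [← this]
  · intro e r her h0
    have h0' : (e : E) ≠ 0 := by simpa using h0
    obtain ⟨s, hs, -⟩ := h.signOp_eigenvector n e.2 her h0'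
    have : L e = (s : ℂ) • ((e : E), (r : ℂ) • (e : E)) := by
      change (signOp A (e : E), signOp A (h.restr n e : E)) = _
      rw [h.coe_restr_eq n e her, map_smul, hs, Prod.smul_mk, smul_comm]
    rw [Submodule.mem_comap, this]
    exact Submodule.smul_mem _ _ her

/-- In an orthonormal eigenbasis the form is `∑ |r i| ‖⟪b i, w⟫‖²`, and every `|r i|` is at least
`c`. -/
lemma re_inner_signOp_of_mem (n : ℕ) (w : W n) :
    c * ‖w‖ ^ 2 ≤ (⟪(w : E), signOp A (h.restr n w : E)⟫_ℂ).re := by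
  have := h.finite n
  have hs := h.isSymmetric_restr n
  let b := hs.eigenvectorBasis rfl
  let r := hs.eigenvalues rfl
  have hb : ∀ i, ((b i : E), (r i : ℂ) • (b i : E)) ∈ A.graph := by
    intro i
    have := h.mem_graph_restr n (b i)
    rwa [hs.apply_eigenvectorBasis rfl i] at this
  have hb0 : ∀ i, (b i : E) ≠ 0 := fun i => by
    simpa using b.orthonormal.ne_zero i
  have hbs : ∀ i, signOp A (h.restr n (b i) : E) = ((|r i| : ℝ) : ℂ) • (b i : E) := by
    intro i
    obtain ⟨s, hs1, hs2⟩ := h.signOp_eigenvector n (b i).2 (hb i) (hb0 i)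
    rw [h.coe_restr_eq n (b i) (hb i), map_smul, hs1, smul_smul, ← hs2]
    push_cast
    rw [mul_comm]
  have hw : signOp A (h.restr n w : E) = ∑ i, (⟪b i, w⟫_ℂ * (|r i| : ℝ)) • (b i : E) := by
    conv_lhs => rw [← b.sum_repr' w]
    simp only [map_sum, map_smul, Submodule.coe_sum, Submodule.coe_smul, hbs, smul_smul]
  have hnorm : ‖w‖ ^ 2 = ∑ i, ‖⟪b i, w⟫_ℂ‖ ^ 2 := (b.sum_sq_norm_inner_right w).symm
  rw [hw, inner_sum, hnorm, Finset.mul_sum, Complex.re_sum]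
  refine Finset.sum_le_sum fun i _ => ?_
  rw [inner_smul_right]
  have e1 : ⟪(w : E), (b i : E)⟫_ℂ = conj ⟪b i, w⟫_ℂ := by
    rw [inner_conj_symm]; rfl
  have e2 : ⟪b i, w⟫_ℂ * ((|r i| : ℝ) : ℂ) * conj ⟪b i, w⟫_ℂ
      = ((|r i| * ‖⟪b i, w⟫_ℂ‖ ^ 2 : ℝ) : ℂ) := by
    rw [mul_right_comm, Complex.mul_conj, Complex.normSq_eq_norm_sq]
    push_cast
    ring
  rw [e1, e2, Complex.ofReal_re]
  exact mul_le_mul_of_nonneg_right (h.gap n _ _ (b i).2 (hb i) (hb0 i)) (by positivity)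

lemma re_inner_signOp {x y : E} (hxy : (x, y) ∈ A.graph) :
    c * ‖x‖ ^ 2 ≤ (⟪x, signOp A y⟫_ℂ).re := by
  obtain ⟨u, v, huv, hu, hv⟩ := h.exists_approx (h.symm _ _ hxy)
  refine le_of_tendsto_of_tendsto' ((hu.norm.pow 2).const_mul c)
    ((Complex.continuous_re.tendsto _).comp
      (hu.inner (((signOp A).continuous.tendsto _).comp hv))) fun n => ?_
  have := h.re_inner_signOp_of_mem n ⟨u n, (huv n).1⟩
  rwa [h.coe_restr_eq n ⟨u n, (huv n).1⟩ (huv n).2] at this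

theorem isPolarSign : IsPolarSign A (signOp A) where
  isSelfAdjoint := isSelfAdjoint_signOp A
  sq := by ext x; exact h.signOp_signOp x
  commutes := (commutesWith_iff_graph _ _).mpr fun x y hxy => h.signOp_graph hxy
  abs_isSelfAdjoint := isSelfAdjoint_compPMap h.isSelfAdjoint (isSelfAdjoint_signOp A)
    h.signOp_signOp fun x y hxy => h.signOp_graph hxy
  abs_pos x hx := lt_of_lt_of_le
    (mul_pos h.gap_pos (pow_pos (norm_pos_iff.mpr hx) 2)) (h.re_inner_signOp (A.mem_graph x))

theorem eq_zero_of_apply_eq_zero (x : A.domain) (hx : A x = 0) : (x : E) = 0 := by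
  by_contra h0
  have := h.isPolarSign.abs_pos x h0
  simp [hx] at this

/-- A self-adjoint involution has eigenprojections `(1 ± S) / 2`; this formula and the next turn
questions about the projections into algebra. -/
lemma eigenProjection_one (x : E) :
    eigenProjection (signOp A) 1 x = (2⁻¹ : ℂ) • (x + signOp A x) := by
  rw [eigenProjection]
  have : CompleteSpace (signOp A - (1 : ℂ) • (1 : E →L[ℂ] E)).ker :=
    (signOp A - (1 : ℂ) • (1 : E →L[ℂ] E)).isClosed_ker.completeSpace_coe
  apply Submodule.eq_starProjection_of_mem_of_inner_eq_zero
  · simp [h.signOp_signOp, add_comm]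
  · intro w hw
    have hw' : signOp A w = w := by simpa [sub_eq_zero] using hw
    have h1 : ⟪signOp A x, w⟫_ℂ = ⟪x, w⟫_ℂ := by
      rw [← inner_apply_right_of_isSelfAdjoint (isSelfAdjoint_signOp A), hw']
    simp only [inner_sub_left, inner_smul_left, inner_add_left, h1, map_inv₀, Complex.conj_ofNat]
    ring

lemma eigenProjection_neg_one (x : E) :
    eigenProjection (signOp A) (-1) x = (2⁻¹ : ℂ) • (x - signOp A x) := by
  rw [eigenProjection]
  have : CompleteSpace (signOp A - (-1 : ℂ) • (1 : E →L[ℂ] E)).ker :=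
    (signOp A - (-1 : ℂ) • (1 : E →L[ℂ] E)).isClosed_ker.completeSpace_coe
  apply Submodule.eq_starProjection_of_mem_of_inner_eq_zero
  · simp [h.signOp_signOp]
  · intro w hw
    have hw' : signOp A w = -w := by simpa [eq_neg_iff_add_eq_zero] using hw
    have h1 : ⟪signOp A x, w⟫_ℂ = -⟪x, w⟫_ℂ := by
      rw [← inner_apply_right_of_isSelfAdjoint (isSelfAdjoint_signOp A), hw', inner_neg_right]
    simp only [inner_sub_left, inner_smul_left, h1, map_inv₀, Complex.conj_ofNat]
    ring

end IsExhaustedBy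

end Exhaustion

end SpinorSphere

namespace SpinorSphere

/-! ### Operators transported to the new complex structure -/

namespace IsComplexStructure

variable {E : Type*} [NormedAddCommGroup E] [InnerProductSpace ℂ E] {J : E →L[ℂ] E}
  (hJ : IsComplexStructure J)

lemma mem_graph_op (A : E →ₗ.[ℂ] E) (hA : CommutesWith J A) (x y : E) :
    (hJ.I x, hJ.I y) ∈ (hJ.op A hA).graph ↔ (x, y) ∈ A.graph := by
  simp only [LinearPMap.mem_graph_iff]
  constructor
  · rintro ⟨z, h1, h2⟩
    refine ⟨⟨hJ.I.symm z, z.2⟩, ?_, ?_⟩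
    · change hJ.I.symm z = x
      rw [h1]; rfl
    · exact hJ.I.injective h2
  · rintro ⟨z, h1, h2⟩
    exact ⟨⟨hJ.I z, z.2⟩, congrArg hJ.I h1, congrArg hJ.I h2⟩

lemma inner_I_eq_iff {a b x y : E} :
    ⟪hJ.I b, hJ.I x⟫_ℂ = ⟪hJ.I a, hJ.I y⟫_ℂ ↔
      (⟪b, x⟫_ℂ).re = (⟪a, y⟫_ℂ).re ∧ (⟪b, J x⟫_ℂ).re = (⟪a, J y⟫_ℂ).re := by
  rw [inner_def, inner_def, Complex.ext_iff]
  simp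

/-- The new inner product is determined by real parts of old ones, with `J` inserted for the
imaginary part. Forward, the graph is stable under `J`. Backward, the real parts suffice, because
replacing `(a, b)` by `(i a, i b)` recovers the imaginary part. -/
lemma isSelfAdjoint_op [CompleteSpace E] {A : E →ₗ.[ℂ] E} (hs : IsSelfAdjoint A)
    (hA : CommutesWith J A) : IsSelfAdjoint (hJ.op A hA) := by
  have hc := (commutesWith_iff_graph J A).mp hA
  apply isSelfAdjoint_of_mem_graph_iff
  · exact hs.dense_domain
  intro x y
  obtain ⟨x, rfl⟩ := hJ.I.surjective x
  obtain ⟨y, rfl⟩ := hJ.I.surjective y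
  rw [mem_graph_op]
  constructor
  · intro hxy a b hab
    obtain ⟨a, rfl⟩ := hJ.I.surjective a
    obtain ⟨b, rfl⟩ := hJ.I.surjective b
    rw [mem_graph_op] at hab
    rw [inner_I_eq_iff, (mem_graph_iff_of_isSelfAdjoint hs _ _).mp hxy _ _ hab,
      (mem_graph_iff_of_isSelfAdjoint hs _ _).mp (hc _ _ hxy) _ _ hab]
    exact ⟨rfl, rfl⟩
  · intro h
    rw [mem_graph_iff_of_isSelfAdjoint hs]
    have hre : ∀ a b, (a, b) ∈ A.graph → (⟪b, x⟫_ℂ).re = (⟪a, y⟫_ℂ).re := fun a b hab =>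
      (hJ.inner_I_eq_iff.mp (h _ _ ((hJ.mem_graph_op A hA _ _).mpr hab))).1
    intro a b hab
    refine Complex.ext (hre a b hab) ?_
    have := hre _ _ (A.graph.smul_mem Complex.I hab)
    simpa [inner_smul_left] using this

end IsComplexStructure

/-! ### The unitary `p₊ + C p₋` for an abstract antiunitary `C` -/

namespace IsExhaustedBy

variable {E : Type*} [NormedAddCommGroup E] [InnerProductSpace ℂ E] [CompleteSpace E]
  {A : E →ₗ.[ℂ] E} {W : ℕ → Submodule ℂ E} {c : ℝ} (h : IsExhaustedBy A W c)
include h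

theorem isComplexStructure : IsComplexStructure (Complex.I • signOp A) where
  sq x := by
    simp only [smul_apply, map_smul, h.signOp_signOp, smul_smul]
    simp
  skew x y := by
    simp only [smul_apply, inner_smul_left, inner_smul_right,
      inner_apply_right_of_isSelfAdjoint (isSelfAdjoint_signOp A), Complex.conj_I, neg_mul]

lemma commutesWith_smul_signOp : CommutesWith (Complex.I • signOp A) A := by
  rw [commutesWith_iff_graph]
  exact fun x y hxy => A.graph.smul_mem Complex.I (h.signOp_graph hxy)

lemma commutesWith_smul_signOp_absOp : CommutesWith (Complex.I • signOp A) (absOp A) := by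
  rw [commutesWith_iff_graph]
  intro x y hxy
  obtain ⟨z, hz, rfl⟩ := (mem_graph_compPMap _ _ _ _).mp hxy
  refine (mem_graph_compPMap _ _ _ _).mpr ⟨Complex.I • signOp A z,
    A.graph.smul_mem Complex.I (h.signOp_graph hz), ?_⟩
  simp

/-- The projections onto the positive and the negative part. -/
lemma eigenProjection_spec (x : E) :
    signOp A (eigenProjection (signOp A) 1 x) = eigenProjection (signOp A) 1 x ∧
    signOp A (eigenProjection (signOp A) (-1) x) = -eigenProjection (signOp A) (-1) x ∧
    eigenProjection (signOp A) 1 x + eigenProjection (signOp A) (-1) x = x := by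
  rw [h.eigenProjection_one, h.eigenProjection_neg_one]
  simp only [map_smul, map_add, map_sub, h.signOp_signOp]
  refine ⟨by module, by module, by module⟩

lemma eigenProjection_add {p q : E} (hp : signOp A p = p) (hq : signOp A q = -q) :
    eigenProjection (signOp A) 1 (p + q) = p ∧ eigenProjection (signOp A) (-1) (p + q) = q := by
  rw [h.eigenProjection_one, h.eigenProjection_neg_one, map_add, hp, hq]
  constructor <;> module

omit h in
lemma norm_add_sq_of_signOp {p q : E} (hp : signOp A p = p) (hq : signOp A q = -q) :
    ‖p + q‖ ^ 2 = ‖p‖ ^ 2 + ‖q‖ ^ 2 := by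
  have h1 := inner_apply_right_of_isSelfAdjoint (isSelfAdjoint_signOp A) p q
  rw [hp, hq, inner_neg_right] at h1
  have h2 : ⟪p, q⟫_ℂ = 0 := by linear_combination (-1 / 2 : ℂ) * h1
  simpa [sq] using norm_add_sq_eq_norm_sq_add_norm_sq_of_inner_eq_zero p q h2

lemma eigenProjection_one_graph {x y : E} (hxy : (x, y) ∈ A.graph) :
    (eigenProjection (signOp A) 1 x, eigenProjection (signOp A) 1 y) ∈ A.graph := by
  rw [h.eigenProjection_one, h.eigenProjection_one]
  exact A.graph.smul_mem _ (A.graph.add_mem hxy (h.signOp_graph hxy))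

lemma eigenProjection_neg_one_graph {x y : E} (hxy : (x, y) ∈ A.graph) :
    (eigenProjection (signOp A) (-1) x, eigenProjection (signOp A) (-1) y) ∈ A.graph := by
  rw [h.eigenProjection_neg_one, h.eigenProjection_neg_one]
  exact A.graph.smul_mem _ (A.graph.sub_mem hxy (h.signOp_graph hxy))

/-- If `C` is an antiunitary operator with `C² = -1` that commutes with `A`, then
`p₊ + C p₋` is a unitary operator onto the space with the new complex structure that commutes
with `A`, and with every additive map that commutes with `C` and the sign of `A`. -/
theorem exists_unitary (C : E →L⋆[ℂ] E) (hC : ∀ x, C (C x) = -x) (hnorm : ∀ x, ‖C x‖ = ‖x‖)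
    (hg : ∀ x y, (x, y) ∈ A.graph → (C x, C y) ∈ A.graph)
    {J : E →L[ℂ] E} (hJ : IsComplexStructure J) (hJA : J = Complex.I • signOp A)
    (hd : CommutesWith J A) :
    ∃ U : E ≃ₗᵢ[ℂ] hJ.Space,
      (∀ x, U x = hJ.I (eigenProjection (signOp A) 1 x + C (eigenProjection (signOp A) (-1) x))) ∧
      (∀ T : E →+ E, (∀ x, T (C x) = C (T x)) → (∀ x, T (signOp A x) = signOp A (T x)) →
        (∀ (r : ℝ) x, T ((r : ℂ) • x) = (r : ℂ) • T x) →
        ∀ x, U (T x) = hJ.I (T (hJ.I.symm (U x)))) ∧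
      (∀ x y, (x, y) ∈ A.graph ↔ (U x, U y) ∈ (hJ.op A hd).graph) := by
  have hSC : ∀ x, signOp A (C x) = C (signOp A x) :=
    h.signOp_comm ((C : E →ₛₗ[starRingEnd ℂ] E) : E →+ E) C.continuous
      (fun d x => ⟨conj d, C.map_smulₛₗ d x⟩)
      (fun r x => by
        change C _ = _ • C x
        rw [C.map_smulₛₗ, Complex.conj_ofReal]) hg
  set p := fun x => eigenProjection (signOp A) 1 x with hp_def
  set q := fun x => eigenProjection (signOp A) (-1) x with hq_def
  have hp : ∀ x, signOp A (p x) = p x := fun x => (h.eigenProjection_spec x).1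
  have hq : ∀ x, signOp A (q x) = -q x := fun x => (h.eigenProjection_spec x).2.1
  have hpq : ∀ x, p x + q x = x := fun x => (h.eigenProjection_spec x).2.2
  have hCq : ∀ x, signOp A (C (q x)) = -C (q x) := fun x => by rw [hSC, hq, map_neg]
  let F : E →ₗᵢ[ℂ] hJ.Space :=
    { toFun := fun x => hJ.I (p x + C (q x))
      map_add' := fun x y => by
        simp only [hp_def, hq_def, map_add]
        abel
      map_smul' := fun d x => by
        -- `J` is `i` on `p x` but `-i` on `C (q x)`, matching the factor `conj d` produced by the
        -- antilinear `C`.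
        have h2 : J (p x + C (q x)) = Complex.I • (p x - C (q x)) := by
          rw [hJA, smul_apply, map_add, hp, hCq, sub_eq_add_neg]
        rw [RingHom.id_apply, IsComplexStructure.smul_def, AddEquiv.symm_apply_apply, h2]
        congr 1
        simp only [hp_def, hq_def, map_smul, C.map_smulₛₗ]
        have h3 : conj d = (d.re : ℂ) - d.im * Complex.I := by
          apply Complex.ext <;> simp
        conv_lhs => rw [h3]
        conv_lhs => enter [1]; rw [← Complex.re_add_im d]
        module
      norm_map' := fun x => by
        change ‖p x + C (q x)‖ = ‖x‖
        rw [← sq_eq_sq₀ (norm_nonneg _) (norm_nonneg _), norm_add_sq_of_signOp (hp x) (hCq x),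
          hnorm, ← norm_add_sq_of_signOp (hp x) (hq x), hpq] }
  have hsurj : Function.Surjective F := by
    intro y
    -- `C² = -1` makes `p - C q` the inverse of `p + C q`.
    refine ⟨p (hJ.I.symm y) - C (q (hJ.I.symm y)), ?_⟩
    change hJ.I (p _ + C (q _)) = y
    obtain ⟨e1, e2⟩ := h.eigenProjection_add (hp (hJ.I.symm y)) (q := -C (q (hJ.I.symm y)))
      (by rw [map_neg, hCq])
    rw [← sub_eq_add_neg] at e1 e2
    simp only [hp_def, hq_def] at e1 e2 ⊢
    rw [e1, e2, map_neg, hC, neg_neg]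
    exact (congrArg hJ.I (hpq (hJ.I.symm y))).trans (hJ.I.apply_symm_apply y)
  refine ⟨LinearIsometryEquiv.ofSurjective F hsurj, fun x => rfl, ?_, ?_⟩
  · intro T hTC hTS hTr x
    change hJ.I (p (T x) + C (q (T x))) = hJ.I (T (p x + C (q x)))
    -- `T` is only assumed homogeneous for real scalars.
    have h2 : (2⁻¹ : ℂ) = ((2⁻¹ : ℝ) : ℂ) := by push_cast; rfl
    have e1 : p (T x) = T (p x) := by
      simp only [hp_def, h.eigenProjection_one]
      rw [h2, hTr, map_add, hTS]
    have e2 : q (T x) = T (q x) := by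
      simp only [hq_def, h.eigenProjection_neg_one]
      rw [h2, hTr, map_sub, hTS]
    rw [e1, e2, T.map_add, hTC]
  · intro x y
    change _ ↔ (hJ.I (p x + C (q x)), hJ.I (p y + C (q y))) ∈ _
    rw [IsComplexStructure.mem_graph_op]
    have hp' : ∀ x y, (x, y) ∈ A.graph → (p x, p y) ∈ A.graph := fun x y hxy =>
      h.eigenProjection_one_graph hxy
    have hq' : ∀ x y, (x, y) ∈ A.graph → (q x, q y) ∈ A.graph := fun x y hxy =>
      h.eigenProjection_neg_one_graph hxy
    refine ⟨fun hxy => A.graph.add_mem (hp' _ _ hxy) (hg _ _ (hq' _ _ hxy)), fun hxy => ?_⟩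
    -- The inverse `p - C q` also preserves the graph, which yields the converse.
    have key := A.graph.sub_mem (hp' _ _ hxy) (hg _ _ (hq' _ _ hxy))
    have e : ∀ x, p (p x + C (q x)) - C (q (p x + C (q x))) = x := by
      intro x
      obtain ⟨e1, e2⟩ := h.eigenProjection_add (hp x) (hCq x)
      simp only [hp_def, hq_def] at e1 e2 ⊢
      rw [e1, e2, hC, sub_neg_eq_add]
      exact hpq x
    rwa [Prod.mk_sub_mk, e, e] at key

end IsExhaustedBy

end SpinorSphere

namespace SpinorSphere

/-! ### Left-invariant derivatives -/

lemma expPauli_zero (j : Fin 3) : expPauli j 0 = 1 := by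
  apply Subtype.ext
  simp [expPauli]

lemma pauli_mul_self (j : Fin 3) : pauli j * pauli j = 1 := by
  ext a b
  fin_cases j <;> fin_cases a <;> fin_cases b <;> simp [pauli, Matrix.mul_apply, Fin.sum_univ_two]

lemma expPauli_add (j : Fin 3) (s t : ℝ) : expPauli j (s + t) = expPauli j s * expPauli j t := by
  apply Subtype.ext
  simp only [expPauli, Submonoid.mk_mul_mk, sub_mul, mul_sub, Matrix.smul_mul, Matrix.mul_smul,
    Matrix.one_mul, Matrix.mul_one, pauli_mul_self, Real.cos_add, Real.sin_add]
  push_cast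
  have hI := Complex.I_sq
  match_scalars
  · ring_nf
    simp [hI]
    ring
  · ring

lemma hasDerivAt_expPauli (j : Fin 3) (a b : Fin 2) :
    HasDerivAt (fun t : ℝ => (expPauli j t).1 a b) (-Complex.I * pauli j a b) 0 := by
  have h1 : HasDerivAt (fun t : ℝ => (Real.cos t : ℂ)) 0 0 := by
    simpa using (Real.hasDerivAt_cos 0).ofReal_comp
  have h2 : HasDerivAt (fun t : ℝ => (Real.sin t : ℂ)) 1 0 := by
    simpa using (Real.hasDerivAt_sin 0).ofReal_comp
  have h3 := (h1.mul_const ((1 : Matrix (Fin 2) (Fin 2) ℂ) a b)).sub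
    ((h2.const_mul Complex.I).mul_const (pauli j a b))
  exact (h3.congr_deriv (by simp)).congr_of_eventuallyEq (.of_forall fun t => by simp [expPauli])

/-- The entries of a matrix in `SU(2)`. -/
def entries (g : SU2) : Fin 2 → Fin 2 → ℂ := fun a b => g.1 a b

lemma continuous_entries : Continuous entries := by
  refine continuous_pi fun a => continuous_pi fun b => ?_
  exact continuous_subtype_val.matrix_elem a b

/-- The value of the left-invariant vector field `X_j` at `g`, as a matrix. -/
def invField (j : Fin 3) (g : SU2) : Fin 2 → Fin 2 → ℂ :=
  fun a b => (g.1 * (-Complex.I • pauli j)) a b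

lemma continuous_invField (j : Fin 3) : Continuous (invField j) := by
  refine continuous_pi fun a => continuous_pi fun b => ?_
  exact (continuous_subtype_val.mul continuous_const).matrix_elem a b

lemma hasDerivAt_entries (j : Fin 3) (g : SU2) :
    HasDerivAt (fun t : ℝ => entries (g * expPauli j t)) (invField j g) 0 := by
  refine hasDerivAt_pi.mpr fun a => hasDerivAt_pi.mpr fun b => ?_
  have : HasDerivAt (fun t : ℝ => ∑ c, g.1 a c * (expPauli j t).1 c b)
      (∑ c, g.1 a c * (-Complex.I * pauli j c b)) 0 :=
    HasDerivAt.fun_sum fun c _ => (hasDerivAt_expPauli j c b).const_mul _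
  simpa [entries, invField, Matrix.mul_apply] using this

/-- `φ'` is the continuous derivative of the continuous function `φ` along `X_j`. -/
structure HasLeftInvDeriv {V : Type*} [NormedAddCommGroup V] [NormedSpace ℝ V] (j : Fin 3)
    (φ φ' : SU2 → V) : Prop where
  continuous : Continuous φ
  continuous' : Continuous φ'
  hasDerivAt : ∀ g, HasDerivAt (fun t : ℝ => φ (g * expPauli j t)) (φ' g) 0

lemma HasLeftInvDeriv.leftInvDeriv_eq {j : Fin 3} {φ φ' : SU2 → Spin}
    (h : HasLeftInvDeriv j φ φ') : leftInvDeriv j φ = φ' :=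
  funext fun g => (h.hasDerivAt g).deriv

lemma hasLeftInvDeriv_of_contDiff (j : Fin 3) {V : Type*} [NormedAddCommGroup V] [NormedSpace ℝ V]
    {Φ : (Fin 2 → Fin 2 → ℂ) → V} (hΦ : ContDiff ℝ ∞ Φ) :
    HasLeftInvDeriv j (fun g => Φ (entries g))
      (fun g => fderiv ℝ Φ (entries g) (invField j g)) where
  continuous := hΦ.continuous.comp continuous_entries
  continuous' := ((hΦ.continuous_fderiv (by simp)).comp continuous_entries).clm_apply
    (continuous_invField j)
  hasDerivAt g := by
    have h1 : HasFDerivAt Φ (fderiv ℝ Φ (entries (g * expPauli j 0)))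
        (entries (g * expPauli j 0)) :=
      (hΦ.differentiable (by simp) _).hasFDerivAt
    have := h1.comp_hasDerivAt (0 : ℝ) (hasDerivAt_entries j g)
    rw [expPauli_zero, mul_one] at this
    exact this

lemma IsSmoothField.hasLeftInvDeriv {φ : SU2 → Spin} (h : IsSmoothField φ) (j : Fin 3) :
    HasLeftInvDeriv j φ (leftInvDeriv j φ) := by
  obtain ⟨Φ, hΦ, hφ⟩ := h
  obtain rfl : φ = fun g => Φ (entries g) := funext hφ
  have := hasLeftInvDeriv_of_contDiff j hΦ
  rwa [this.leftInvDeriv_eq]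

lemma HasLeftInvDeriv.comp_clm {j : Fin 3} {V V' : Type*} [NormedAddCommGroup V]
    [NormedSpace ℝ V] [NormedAddCommGroup V'] [NormedSpace ℝ V'] {φ φ' : SU2 → V}
    (h : HasLeftInvDeriv j φ φ') (L : V →L[ℝ] V') :
    HasLeftInvDeriv j (fun g => L (φ g)) (fun g => L (φ' g)) where
  continuous := L.continuous.comp h.continuous
  continuous' := L.continuous.comp h.continuous'
  hasDerivAt g := L.hasFDerivAt.comp_hasDerivAt (0 : ℝ) (h.hasDerivAt g)

lemma HasLeftInvDeriv.inner {j : Fin 3} {φ φ' χ χ' : SU2 → Spin}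
    (h : HasLeftInvDeriv j φ φ') (k : HasLeftInvDeriv j χ χ') :
    HasLeftInvDeriv j (fun g => ⟪φ g, χ g⟫_ℂ) (fun g => ⟪φ g, χ' g⟫_ℂ + ⟪φ' g, χ g⟫_ℂ) where
  continuous := h.continuous.inner k.continuous
  continuous' := (h.continuous.inner k.continuous').add (h.continuous'.inner k.continuous)
  hasDerivAt g := by
    simpa [expPauli_zero] using (h.hasDerivAt g).inner ℂ (k.hasDerivAt g)

/-! ### Integration by parts for Haar measure -/

section Integral

variable (μ : Measure SU2) [μ.IsHaarMeasure]

lemma integrable_of_continuous {V : Type*} [NormedAddCommGroup V] [SecondCountableTopology V]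
    [MeasurableSpace V] [BorelSpace V] {f : SU2 → V}
    (hf : Continuous f) : Integrable f μ :=
  hf.integrable_of_hasCompactSupport (HasCompactSupport.of_compactSpace f)

lemma integral_mul_right_SU2 {f : SU2 → ℂ} (k : SU2) :
    ∫ g, f (g * k) ∂μ = ∫ g, f g ∂μ := by
  have h := measurePreserving_action μ (1, k)
  simp only [inv_one, one_mul] at h
  exact h.integral_comp (Homeomorph.mulRight k).measurableEmbedding f

/-- The integral of a derivative along a left-invariant vector field vanishes. -/
lemma HasLeftInvDeriv.integral_eq_zero {j : Fin 3} {f f' : SU2 → ℂ}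
    (h : HasLeftInvDeriv j f f') : ∫ g, f' g ∂μ = 0 := by
  obtain ⟨C, hC⟩ := (isCompact_range h.continuous'.norm).bddAbove
  have hmul : ∀ t, Continuous fun g : SU2 => g * expPauli j t := fun t =>
    continuous_id.mul continuous_const
  -- The one-parameter group law carries the derivative at time `0` to every time `t`.
  have hder : ∀ (g : SU2) (t : ℝ),
      HasDerivAt (fun s => f (g * expPauli j s)) (f' (g * expPauli j t)) t := by
    intro g t
    have h1 := h.hasDerivAt (g * expPauli j t)
    have h2 : HasDerivAt (fun s : ℝ => s - t) 1 t := (hasDerivAt_id t).sub_const t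
    rw [← sub_self t] at h1
    have h3 := HasDerivAt.scomp (h := fun s : ℝ => s - t) t h1 h2
    rw [one_smul] at h3
    refine h3.congr_of_eventuallyEq (Filter.Eventually.of_forall fun s => ?_)
    simp only [Function.comp_apply]
    rw [mul_assoc, ← expPauli_add, add_sub_cancel]
  have key := (hasDerivAt_integral_of_dominated_loc_of_deriv_le (μ := μ) (x₀ := (0 : ℝ))
    (F := fun t g => f (g * expPauli j t)) (F' := fun t g => f' (g * expPauli j t))
    (bound := fun _ => C) Filter.univ_mem
    (Filter.Eventually.of_forall fun t =>
      (h.continuous.comp (hmul t)).aestronglyMeasurable)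
    (integrable_of_continuous μ (h.continuous.comp (hmul 0)))
    (h.continuous'.comp (hmul 0)).aestronglyMeasurable
    (Filter.Eventually.of_forall fun g t _ => hC ⟨_, rfl⟩)
    (integrable_const C)
    (Filter.Eventually.of_forall fun g t _ => hder g t)).2
  -- By right invariance the integral being differentiated does not depend on `t`.
  simp only [integral_mul_right_SU2 μ] at key
  exact key.unique (hasDerivAt_const _ _)

lemma HasLeftInvDeriv.integral_inner {j : Fin 3} {φ φ' χ χ' : SU2 → Spin}
    (h : HasLeftInvDeriv j φ φ') (k : HasLeftInvDeriv j χ χ') :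
    ∫ g, ⟪φ' g, χ g⟫_ℂ ∂μ = -∫ g, ⟪φ g, χ' g⟫_ℂ ∂μ := by
  have h1 := (h.inner k).integral_eq_zero μ
  rw [integral_add (integrable_of_continuous μ (h.continuous.inner k.continuous'))
    (integrable_of_continuous μ (h.continuous'.inner k.continuous))] at h1
  linear_combination h1

omit [μ.IsHaarMeasure] in
lemma inner_eq_integral {a b : SpinorL2 μ} {φ χ : SU2 → Spin} (ha : a =ᵐ[μ] φ) (hb : b =ᵐ[μ] χ) :
    ⟪a, b⟫_ℂ = ∫ g, ⟪φ g, χ g⟫_ℂ ∂μ := by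
  rw [L2.inner_def]
  refine integral_congr_ae ?_
  filter_upwards [ha, hb] with g h1 h2
  rw [h1, h2]

end Integral

lemma star_pauli (j : Fin 3) : star (pauli j) = pauli j := by
  ext a b
  fin_cases j <;> fin_cases a <;> fin_cases b <;> simp [pauli, Matrix.star_apply]

lemma inner_mat_pauli (j : Fin 3) (v w : Spin) :
    ⟪mat (pauli j) v, w⟫_ℂ = ⟪v, mat (pauli j) w⟫_ℂ := by
  have h2 : star (mat (pauli j)) = mat (pauli j) := by
    rw [mat, ← map_star, star_pauli]
  rw [← ContinuousLinearMap.adjoint_inner_right, ← ContinuousLinearMap.star_eq_adjoint, h2]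

lemma IsSmoothField.continuous {φ : SU2 → Spin} (h : IsSmoothField φ) : Continuous φ :=
  (h.hasLeftInvDeriv 0).continuous

/-- The Dirac operator on smooth fields is symmetric. -/
lemma integral_inner_diracSmooth (μ : Measure SU2) [μ.IsHaarMeasure] {φ χ : SU2 → Spin}
    (h : IsSmoothField φ) (k : IsSmoothField χ) :
    ∫ g, ⟪diracSmooth φ g, χ g⟫_ℂ ∂μ = ∫ g, ⟪φ g, diracSmooth χ g⟫_ℂ ∂μ := by
  have hφ := h.continuous
  have hχ := k.continuous
  have hφ' := fun j => (h.hasLeftInvDeriv j).continuous'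
  have hχ' := fun j => (k.hasLeftInvDeriv j).continuous'
  -- The sign from integrating by parts cancels the sign of `conj i = -i`, and `σ_j` is
  -- self-adjoint.
  have e1 : ∀ j, ∫ g, ⟪Complex.I • mat (pauli j) (leftInvDeriv j φ g), χ g⟫_ℂ ∂μ =
      ∫ g, ⟪φ g, Complex.I • mat (pauli j) (leftInvDeriv j χ g)⟫_ℂ ∂μ := by
    intro j
    have h1 := (h.hasLeftInvDeriv j).integral_inner μ
      ((k.hasLeftInvDeriv j).comp_clm ((mat (pauli j)).restrictScalars ℝ))
    simp only [ContinuousLinearMap.coe_restrictScalars'] at h1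
    simp only [inner_smul_left, inner_smul_right, integral_const_mul, inner_mat_pauli, h1,
      Complex.conj_I]
    ring
  simp only [diracSmooth, inner_add_left, inner_add_right, sum_inner, inner_sum]
  rw [integral_add, integral_add, integral_finsetSum, integral_finsetSum]
  · congr 1
    · exact Finset.sum_congr rfl fun j _ => e1 j
    · simp [inner_smul_left, inner_smul_right, Complex.conj_ofNat]
  all_goals first
    | (intro j _; exact integrable_of_continuous μ (by have := hφ' j; have := hχ' j; fun_prop))
    | exact integrable_of_continuous μ (by fun_prop)

end SpinorSphere

namespace SpinorSphere

/-! ### Polynomial spinor fields -/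

/-- Polynomials in the entries of a `2 × 2` matrix. -/
abbrev EntryPoly : Type := MvPolynomial (Fin 2 × Fin 2) ℂ

/-- The left-invariant vector field `X_j` as a derivation of polynomials. -/
noncomputable def invDer (j : Fin 3) : Derivation ℂ EntryPoly EntryPoly :=
  MvPolynomial.mkDerivation ℂ fun ab =>
    ∑ c, (-Complex.I * pauli j c ab.2) • MvPolynomial.X (ab.1, c)

lemma invDer_X (j : Fin 3) (a b : Fin 2) : invDer j (MvPolynomial.X (a, b)) =
    ∑ c, (-Complex.I * pauli j c b) • (MvPolynomial.X (a, c) : EntryPoly) :=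
  MvPolynomial.mkDerivation_X _ _ _

/-- A derivation is determined by the variables, where `X_j` is right multiplication by `-iσ_j`; and
`[-iσ_j, -iσ_k] = 2(-iσ_l)`. -/
lemma invDer_comm (j k l : Fin 3) (h : pauli j * pauli k - pauli k * pauli j =
    (2 * Complex.I) • pauli l) (p : EntryPoly) :
    invDer j (invDer k p) = invDer k (invDer j p) + (2 : ℂ) • invDer l p := by
  have key : ⁅invDer j, invDer k⁆ = (2 : ℂ) • invDer l := by
    refine MvPolynomial.derivation_ext fun ab => ?_
    obtain ⟨a, b⟩ := ab
    have hb : ∀ c, (∑ d, (pauli j c d * pauli k d b - pauli k c d * pauli j d b)) =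
        2 * Complex.I * pauli l c b := by
      intro c
      have := congrFun (congrFun h c) b
      simpa [Matrix.mul_apply] using this
    have h0 := hb 0
    have h1 := hb 1
    simp only [Fin.sum_univ_two] at h0 h1
    simp only [Derivation.commutator_apply, Derivation.smul_apply, invDer_X, Fin.sum_univ_two,
      map_add, Derivation.map_smul]
    have hI := Complex.I_sq
    match_scalars
    · linear_combination (pauli j 0 0 * pauli k 0 b + pauli j 0 1 * pauli k 1 b
        - pauli k 0 0 * pauli j 0 b - pauli k 0 1 * pauli j 1 b) * hI - h0
    · linear_combination (pauli j 1 0 * pauli k 0 b + pauli j 1 1 * pauli k 1 b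
        - pauli k 1 0 * pauli j 0 b - pauli k 1 1 * pauli j 1 b) * hI - h1
  have := congrArg (fun D : Derivation ℂ EntryPoly EntryPoly => D p) key
  simp only [Derivation.commutator_apply, Derivation.smul_apply] at this
  rw [← this]
  abel

lemma pauli_comm :
    (pauli 0 * pauli 1 - pauli 1 * pauli 0 = (2 * Complex.I) • pauli 2) ∧
    (pauli 1 * pauli 2 - pauli 2 * pauli 1 = (2 * Complex.I) • pauli 0) ∧
    (pauli 2 * pauli 0 - pauli 0 * pauli 2 = (2 * Complex.I) • pauli 1) := by
  refine ⟨?_, ?_, ?_⟩ <;> ext a b <;> fin_cases a <;> fin_cases b <;>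
    simp [pauli, two_mul, add_mul] <;> ring

/-- The operator `∑_j i σ_j X_j` on polynomial spinor fields. -/
noncomputable def polySpin : (Fin 2 → EntryPoly) →ₗ[ℂ] (Fin 2 → EntryPoly) where
  toFun p k := ∑ j, ∑ l, (Complex.I * pauli j k l) • invDer j (p l)
  map_add' p q := by
    ext1 k
    simp [Finset.sum_add_distrib]
  map_smul' c p := by
    ext1 k
    simp only [Pi.smul_apply, Derivation.map_smul, RingHom.id_apply, Finset.smul_sum]
    exact Finset.sum_congr rfl fun j _ => Finset.sum_congr rfl fun l _ => smul_comm _ _ _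

lemma polySpin_apply (p : Fin 2 → EntryPoly) (k : Fin 2) :
    polySpin p k = ∑ j, ∑ l, (Complex.I * pauli j k l) • invDer j (p l) := rfl

/-- The identity `T² + 2 T = -∑_j X_j²` for `T = ∑_j i σ_j X_j`. -/
lemma polySpin_polySpin (p : Fin 2 → EntryPoly) (k : Fin 2) :
    polySpin (polySpin p) k + (2 : ℂ) • polySpin p k = -∑ j, invDer j (invDer j (p k)) := by
  obtain ⟨h01, h12, h20⟩ := pauli_comm
  -- These relations fix an order for mixed second derivatives. The commutators they leave behind
  -- account for the term `2 T`.
  have e01 := invDer_comm 0 1 2 h01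
  have e12 := invDer_comm 1 2 0 h12
  have e20 := invDer_comm 2 0 1 h20
  have hI := Complex.I_sq
  have hI4 : Complex.I ^ 4 = 1 := Complex.I_pow_four
  fin_cases k <;>
  simp only [polySpin_apply, Fin.sum_univ_three, Fin.sum_univ_two, pauli, Matrix.cons_val_zero,
    Matrix.cons_val_one, Matrix.cons_val, Matrix.of_apply, Fin.zero_eta, Fin.mk_one, map_add,
    Derivation.map_smul, e01, e12, e20] <;>
  match_scalars <;> ring_nf <;> simp [hI, hI4]

/-- Polynomials as continuous functions on `SU(2)`. -/
noncomputable def evalC : EntryPoly →ₐ[ℂ] C(SU2, ℂ) :=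
  MvPolynomial.aeval fun ab => ⟨fun g => g.1 ab.1 ab.2,
    continuous_subtype_val.matrix_elem ab.1 ab.2⟩

lemma evalC_X (a b : Fin 2) (g : SU2) : evalC (MvPolynomial.X (a, b)) g = g.1 a b := by
  simp [evalC]

lemma evalC_C (c : ℂ) (g : SU2) : evalC (MvPolynomial.C c) g = c := by
  simp [evalC]

/-- Both the formal and the analytic derivative obey the Leibniz rule, so constants and matrix
entries decide. -/
lemma hasLeftInvDeriv_evalC (j : Fin 3) (p : EntryPoly) :
    HasLeftInvDeriv j (evalC p) (evalC (invDer j p)) where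
  continuous := map_continuous _
  continuous' := map_continuous _
  hasDerivAt g := by
    induction p using MvPolynomial.induction_on with
    | C c =>
      have : invDer j (MvPolynomial.C c) = 0 := MvPolynomial.derivation_C _ _
      simpa only [this, map_zero, evalC_C, ContinuousMap.zero_apply] using hasDerivAt_const _ _
    | add p q hp hq => simpa using hp.fun_add hq
    | mul_X p ab hp =>
      obtain ⟨a, b⟩ := ab
      have h1 : HasDerivAt (fun t : ℝ => evalC (MvPolynomial.X (a, b)) (g * expPauli j t))
          (evalC (invDer j (MvPolynomial.X (a, b))) g) 0 := by
        simp only [evalC_X]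
        have := (hasDerivAt_pi.mp ((hasDerivAt_pi.mp (hasDerivAt_entries j g)) a)) b
        refine this.congr_deriv ?_
        rw [invDer_X]
        simp [invField, Matrix.mul_apply, evalC_X, Fin.sum_univ_two]
        ring
      have := hp.fun_mul h1
      simp only [expPauli_zero, mul_one] at this
      simp only [map_mul, ContinuousMap.mul_apply, Derivation.leibniz, map_add,
        ContinuousMap.add_apply, smul_eq_mul]
      exact this.congr_deriv (by ring)

lemma exists_contDiff_evalC (p : EntryPoly) :
    ∃ Φ : (Fin 2 → Fin 2 → ℂ) → ℂ, ContDiff ℝ ∞ Φ ∧ ∀ g, evalC p g = Φ (entries g) := by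
  induction p using MvPolynomial.induction_on with
  | C c => exact ⟨fun _ => c, contDiff_const, evalC_C c⟩
  | add p q hp hq =>
    obtain ⟨Φ, h1, h2⟩ := hp
    obtain ⟨Ψ, h3, h4⟩ := hq
    exact ⟨fun A => Φ A + Ψ A, h1.add h3, fun g => by simp [h2, h4]⟩
  | mul_X p ab hp =>
    obtain ⟨Φ, h1, h2⟩ := hp
    obtain ⟨a, b⟩ := ab
    exact ⟨fun A => Φ A * A a b, h1.mul (by fun_prop), fun g => by simp [h2, evalC_X, entries]⟩

/-- The spinor field with polynomial components. -/
noncomputable def polyField : (Fin 2 → EntryPoly) →ₗ[ℂ] C(SU2, Spin) where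
  toFun p := ⟨fun g => WithLp.toLp 2 fun k => evalC (p k) g, by fun_prop⟩
  map_add' p q := by ext g k; simp
  map_smul' c p := by ext g k; simp

lemma polyField_apply (p : Fin 2 → EntryPoly) (g : SU2) (k : Fin 2) :
    polyField p g k = evalC (p k) g := rfl

lemma hasLeftInvDeriv_polyField (j : Fin 3) (p : Fin 2 → EntryPoly) :
    HasLeftInvDeriv j (polyField p) (polyField fun k => invDer j (p k)) := by
  have h : HasLeftInvDeriv j (fun g k => evalC (p k) g) (fun g k => evalC (invDer j (p k)) g) :=
    ⟨by fun_prop, by fun_prop,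
      fun g => hasDerivAt_pi.mpr fun k => (hasLeftInvDeriv_evalC j (p k)).hasDerivAt g⟩
  exact h.comp_clm
    (((EuclideanSpace.equiv (Fin 2) ℂ).symm : (Fin 2 → ℂ) →L[ℂ] Spin).restrictScalars ℝ)

lemma isSmoothField_polyField (p : Fin 2 → EntryPoly) : IsSmoothField (polyField p) := by
  choose Φ h1 h2 using exists_contDiff_evalC
  refine ⟨fun A => ((EuclideanSpace.equiv (Fin 2) ℂ).symm : (Fin 2 → ℂ) →L[ℂ] Spin)
    (fun k => Φ (p k) A), ?_, fun g => ?_⟩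
  · exact (((EuclideanSpace.equiv (Fin 2) ℂ).symm : (Fin 2 → ℂ) →L[ℂ] Spin).restrictScalars
      ℝ).contDiff.comp (contDiff_pi.mpr fun k => h1 (p k))
  · ext k
    exact h2 (p k) g

lemma mat_apply (M : Matrix (Fin 2) (Fin 2) ℂ) (v : Spin) (k : Fin 2) :
    mat M v k = ∑ l, M k l * v l := rfl

/-- The Dirac operator on polynomial spinor fields. -/
noncomputable def polyDirac : (Fin 2 → EntryPoly) →ₗ[ℂ] (Fin 2 → EntryPoly) :=
  polySpin + (3 / 2 : ℂ) • LinearMap.id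

lemma diracSmooth_polyField (p : Fin 2 → EntryPoly) :
    diracSmooth (polyField p) = polyField (polyDirac p) := by
  funext g
  ext k
  simp only [diracSmooth, (hasLeftInvDeriv_polyField _ p).leftInvDeriv_eq, polyDirac,
    LinearMap.add_apply, LinearMap.smul_apply, LinearMap.id_apply, map_add, map_smul]
  simp only [PiLp.add_apply, PiLp.smul_apply, ContinuousMap.add_apply, ContinuousMap.smul_apply,
    polyField_apply, polySpin_apply, Fin.sum_univ_three, mat_apply, Fin.sum_univ_two, map_add,
    map_smul, smul_eq_mul]
  ring

/-! ### The filtration by degree -/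

/-- The span of `1` and the matrix entries. -/
noncomputable def affinePoly : Submodule ℂ EntryPoly :=
  Submodule.span ℂ (insert 1 (Set.range MvPolynomial.X))

lemma one_le_affinePoly : 1 ≤ affinePoly := by
  rw [Submodule.one_le]
  exact Submodule.subset_span (Set.mem_insert _ _)

lemma X_mem_affinePoly (ab : Fin 2 × Fin 2) : (MvPolynomial.X ab : EntryPoly) ∈ affinePoly :=
  Submodule.subset_span (Set.mem_insert_of_mem _ ⟨ab, rfl⟩)

/-- Including `1` among the generators makes the powers an increasing filtration. -/
lemma affinePoly_pow_mono : Monotone fun n : ℕ => affinePoly ^ n :=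
  pow_right_monotone one_le_affinePoly

lemma invDer_mem_affinePoly (j : Fin 3) {p : EntryPoly} (hp : p ∈ affinePoly) :
    invDer j p ∈ affinePoly := by
  induction hp using Submodule.span_induction with
  | mem p hp =>
    rcases hp with rfl | ⟨⟨a, b⟩, rfl⟩
    · rw [Derivation.map_one_eq_zero]; exact zero_mem _
    · rw [invDer_X]
      exact sum_mem fun c _ => Submodule.smul_mem _ _ (X_mem_affinePoly _)
  | zero => rw [map_zero]; exact zero_mem _
  | add p q _ _ h1 h2 => rw [map_add]; exact add_mem h1 h2
  | smul c p _ h1 => rw [Derivation.map_smul]; exact Submodule.smul_mem _ _ h1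

lemma invDer_mem_affinePoly_pow (j : Fin 3) (n : ℕ) {p : EntryPoly} (hp : p ∈ affinePoly ^ n) :
    invDer j p ∈ affinePoly ^ n := by
  induction n generalizing p with
  | zero =>
    rw [pow_zero, Submodule.mem_one] at hp
    obtain ⟨c, rfl⟩ := hp
    rw [Derivation.map_algebraMap]
    exact zero_mem _
  | succ n ih =>
    rw [pow_succ] at hp ⊢
    induction hp using Submodule.mul_induction_on' with
    | mem_mul_mem p hp q hq =>
      rw [Derivation.leibniz, smul_eq_mul, smul_eq_mul, mul_comm q]
      exact add_mem (Submodule.mul_mem_mul hp (invDer_mem_affinePoly j hq))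
        (Submodule.mul_mem_mul (ih hp) hq)
    | add p _ q _ h1 h2 => rw [map_add]; exact add_mem h1 h2

lemma exists_mem_affinePoly_pow (p : EntryPoly) : ∃ n, p ∈ affinePoly ^ n := by
  induction p using MvPolynomial.induction_on with
  | C c => exact ⟨0, by rw [pow_zero, Submodule.mem_one]; exact ⟨c, rfl⟩⟩
  | add p q hp hq =>
    obtain ⟨m, hm⟩ := hp
    obtain ⟨n, hn⟩ := hq
    exact ⟨max m n, add_mem (affinePoly_pow_mono (le_max_left m n) hm)
      (affinePoly_pow_mono (le_max_right m n) hn)⟩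
  | mul_X p ab hp =>
    obtain ⟨n, hn⟩ := hp
    exact ⟨n + 1, by rw [pow_succ]; exact Submodule.mul_mem_mul hn (X_mem_affinePoly ab)⟩

lemma fg_affinePoly_pow (n : ℕ) : (affinePoly ^ n).FG :=
  (Submodule.fg_span ((Set.finite_range _).insert _)).pow n

/-- Spinor fields with components in the `n`-th step of the filtration. -/
noncomputable def polySpinors (n : ℕ) : Submodule ℂ (Fin 2 → EntryPoly) :=
  Submodule.pi Set.univ fun _ => affinePoly ^ n

lemma mem_polySpinors {n : ℕ} {p : Fin 2 → EntryPoly} :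
    p ∈ polySpinors n ↔ ∀ k, p k ∈ affinePoly ^ n := by
  simp [polySpinors]

lemma fg_polySpinors (n : ℕ) : (polySpinors n).FG :=
  Submodule.fg_pi fun _ => fg_affinePoly_pow n

lemma polyDirac_mem (n : ℕ) {p : Fin 2 → EntryPoly} (hp : p ∈ polySpinors n) :
    polyDirac p ∈ polySpinors n := by
  rw [mem_polySpinors] at hp ⊢
  intro k
  refine add_mem (?_ : polySpin p k ∈ _) (Submodule.smul_mem _ _ (hp k))
  rw [polySpin_apply]
  refine sum_mem fun j _ => sum_mem fun l _ => ?_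
  exact Submodule.smul_mem _ _ (invDer_mem_affinePoly_pow j n (hp l))

end SpinorSphere

namespace SpinorSphere

/-! ### Density of the polynomial spinor fields -/

lemma star_eq_adjugate (g : SU2) : star g.1 = g.1.adjugate := by
  have h1 : star g.1 * g.1 = 1 := g.2.1.1
  have h2 : g.1 * g.1.adjugate = 1 := by
    rw [Matrix.mul_adjugate, show g.1.det = 1 from g.2.2, one_smul]
  calc star g.1 = star g.1 * (g.1 * g.1.adjugate) := by rw [h2, mul_one]
    _ = g.1.adjugate := by rw [← mul_assoc, h1, one_mul]

/-- The adjoint of `g` is its adjugate. So conjugation permutes the entries up to sign, which makes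
the polynomials a star algebra and `C` equivariant. -/
lemma conj_entries (g : SU2) :
    conj (g.1 0 0) = g.1 1 1 ∧ conj (g.1 0 1) = -g.1 1 0 ∧
    conj (g.1 1 0) = -g.1 0 1 ∧ conj (g.1 1 1) = g.1 0 0 := by
  have h := star_eq_adjugate g
  rw [Matrix.adjugate_fin_two] at h
  have e := fun a b => congrFun (congrFun h a) b
  exact ⟨by simpa [Matrix.star_apply] using e 0 0, by simpa [Matrix.star_apply] using e 1 0,
    by simpa [Matrix.star_apply] using e 0 1, by simpa [Matrix.star_apply] using e 1 1⟩

lemma exists_evalC_eq_star (p : EntryPoly) : ∃ q, evalC q = star (evalC p) := by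
  induction p using MvPolynomial.induction_on with
  | C c => exact ⟨MvPolynomial.C (conj c), by ext g; simp⟩
  | add p q hp hq =>
    obtain ⟨p', hp⟩ := hp
    obtain ⟨q', hq⟩ := hq
    exact ⟨p' + q', by simp [hp, hq]⟩
  | mul_X p ab hp =>
    obtain ⟨p', hp⟩ := hp
    have key : ∃ q, evalC q = star (evalC (MvPolynomial.X ab)) := by
      obtain ⟨a, b⟩ := ab
      have h := conj_entries
      fin_cases a <;> fin_cases b
      · exact ⟨MvPolynomial.X (1, 1), by ext g; simp [evalC_X, h]⟩
      · exact ⟨-MvPolynomial.X (1, 0), by ext g; simp [evalC_X, h]⟩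
      · exact ⟨-MvPolynomial.X (0, 1), by ext g; simp [evalC_X, h]⟩
      · exact ⟨MvPolynomial.X (0, 0), by ext g; simp [evalC_X, h]⟩
    obtain ⟨q, hq⟩ := key
    exact ⟨p' * q, by rw [map_mul, map_mul, hp, hq, star_mul, mul_comm]⟩

/-- Polynomials in the matrix entries are dense in the continuous functions on `SU(2)`. -/
lemma denseRange_evalC : DenseRange evalC := by
  let S : StarSubalgebra ℂ C(SU2, ℂ) :=
    { evalC.range with
      star_mem' := by
        rintro _ ⟨p, rfl⟩
        obtain ⟨q, hq⟩ := exists_evalC_eq_star p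
        exact ⟨q, hq⟩ }
  have hS : S.SeparatesPoints := by
    intro g k hgk
    by_contra! hcon
    apply hgk
    apply Subtype.ext
    ext a b
    have := hcon (evalC (MvPolynomial.X (a, b))) ⟨_, ⟨_, rfl⟩, rfl⟩
    simpa [evalC_X] using this
  have htop := ContinuousMap.starSubalgebra_topologicalClosure_eq_top_of_separatesPoints S hS
  intro f
  have hf : f ∈ S.topologicalClosure := by rw [htop]; trivial
  exact hf

variable (μ : Measure SU2) [μ.IsHaarMeasure]

/-- The `L²` class of a polynomial spinor field. -/
noncomputable def polyClass : (Fin 2 → EntryPoly) →ₗ[ℂ] SpinorL2 μ :=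
  (ContinuousMap.toLp (E := Spin) 2 μ ℂ : C(SU2, Spin) →ₗ[ℂ] SpinorL2 μ) ∘ₗ polyField

lemma coeFn_polyClass (p : Fin 2 → EntryPoly) : polyClass μ p =ᵐ[μ] polyField p :=
  ContinuousMap.coeFn_toLp (E := Spin) (p := 2) μ (𝕜 := ℂ) (polyField p)

/-- The `L²` classes of the spinor fields in the `n`-th step of the filtration. -/
noncomputable def polyL2 (n : ℕ) : Submodule ℂ (SpinorL2 μ) := (polySpinors n).map (polyClass μ)

lemma polyL2_mono : Monotone (polyL2 μ) := fun _ _ hmn =>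
  Submodule.map_mono fun _ hp => mem_polySpinors.mpr fun k =>
    affinePoly_pow_mono hmn (mem_polySpinors.mp hp k)

lemma polyClass_mem_iSup (p : Fin 2 → EntryPoly) : polyClass μ p ∈ ⨆ n, polyL2 μ n := by
  obtain ⟨m, hm⟩ := exists_mem_affinePoly_pow (p 0)
  obtain ⟨n, hn⟩ := exists_mem_affinePoly_pow (p 1)
  refine Submodule.mem_iSup_of_mem (max m n) ⟨p, mem_polySpinors.mpr fun k => ?_, rfl⟩
  fin_cases k
  · exact affinePoly_pow_mono (le_max_left m n) hm
  · exact affinePoly_pow_mono (le_max_right m n) hn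

/-- Uniform approximation is done one component at a time; the map to `L²` is continuous with dense
range. -/
lemma dense_polyL2 : (⨆ n, polyL2 μ n).topologicalClosure = ⊤ := by
  set V := (⨆ n, polyL2 μ n).topologicalClosure
  have hV : IsClosed (V : Set (SpinorL2 μ)) := Submodule.isClosed_topologicalClosure _
  let T : C(SU2, Spin) →L[ℂ] SpinorL2 μ := ContinuousMap.toLp (E := Spin) 2 μ ℂ
  let ι : Fin 2 → C(SU2, ℂ) → C(SU2, Spin) := fun k f =>
    ⟨fun g => f g • EuclideanSpace.single k (1 : ℂ), by fun_prop⟩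
  have hι : ∀ k, Continuous (ι k) := fun k =>
    (ContinuousMap.continuous_postcomp
      (⟨fun z : ℂ => z • EuclideanSpace.single k (1 : ℂ), by fun_prop⟩ : C(ℂ, Spin)))
  have h1 : ∀ k f, T (ι k f) ∈ V := by
    intro k f
    have hcl : IsClosed ((fun f => T (ι k f)) ⁻¹' (V : Set (SpinorL2 μ))) :=
      hV.preimage (T.continuous.comp (hι k))
    refine denseRange_evalC.induction_on (p := fun f => T (ι k f) ∈ V) f hcl fun p => ?_
    have : ι k (evalC p) = polyField (Pi.single k p) := by
      ext g l
      by_cases hkl : l = k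
      · subst hkl; simp [ι, polyField_apply]
      · simp [ι, polyField_apply, hkl]
    rw [this]
    exact Submodule.le_topologicalClosure _ (polyClass_mem_iSup μ (Pi.single k p))
  have h2 : ∀ φ : C(SU2, Spin), T φ ∈ V := by
    intro φ
    have : φ = ∑ k, ι k ⟨fun g => φ g k, by fun_prop⟩ := by
      ext g l
      fin_cases l <;> simp [ι, Fin.sum_univ_two]
    rw [this, map_sum]
    exact sum_mem fun k _ => h1 k _
  rw [Submodule.eq_top_iff']
  intro x
  exact (ContinuousMap.toLp_denseRange Spin μ ℂ (p := 2) (by simp)).induction_on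
    (p := fun x => x ∈ V) x hV h2

/-! ### The Dirac operator on polynomial spinor fields -/

lemma inner_diracSmooth {φ χ : SU2 → Spin} (h : IsSmoothField φ) (k : IsSmoothField χ)
    {a a' b b' : SpinorL2 μ} (ha : a =ᵐ[μ] φ) (ha' : a' =ᵐ[μ] diracSmooth φ)
    (hb : b =ᵐ[μ] χ) (hb' : b' =ᵐ[μ] diracSmooth χ) : ⟪a', b⟫_ℂ = ⟪a, b'⟫_ℂ := by
  rw [inner_eq_integral μ ha' hb, inner_eq_integral μ ha hb', integral_inner_diracSmooth μ h k]

lemma coeFn_polyClass_polyDirac (p : Fin 2 → EntryPoly) :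
    polyClass μ (polyDirac p) =ᵐ[μ] diracSmooth (polyField p) := by
  rw [diracSmooth_polyField]
  exact coeFn_polyClass μ _

/-- Symmetry on smooth fields is exactly the distributional equation here. -/
lemma polyClass_mem_diracGraph (p : Fin 2 → EntryPoly) :
    (polyClass μ p, polyClass μ (polyDirac p)) ∈ diracGraph μ :=
  fun _ _ _ hφ ha hb => inner_diracSmooth μ hφ (isSmoothField_polyField p) ha hb
    (coeFn_polyClass μ p) (coeFn_polyClass_polyDirac μ p)

lemma inner_polyClass_of_mem_diracGraph {x y : SpinorL2 μ} (h : (x, y) ∈ diracGraph μ)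
    (p : Fin 2 → EntryPoly) : ⟪polyClass μ (polyDirac p), x⟫_ℂ = ⟪polyClass μ p, y⟫_ℂ :=
  h _ _ _ (isSmoothField_polyField p) (coeFn_polyClass μ p) (coeFn_polyClass_polyDirac μ p)

/-- The relation must be single-valued to be the graph of the operator built from it: if `x = 0`,
then `y` is orthogonal to the dense polynomial fields. -/
lemma graph_dirac : (dirac μ).graph = diracGraph μ := by
  apply Submodule.toLinearPMap_graph_eq
  rintro ⟨x, y⟩ hxy rfl
  have hdense : Dense ((⨆ n, polyL2 μ n : Submodule ℂ (SpinorL2 μ)) : Set (SpinorL2 μ)) :=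
    Submodule.dense_iff_topologicalClosure_eq_top.mpr (dense_polyL2 μ)
  refine hdense.eq_zero_of_inner_right ℂ fun v hv => ?_
  induction hv using Submodule.iSup_induction' with
  | mem n v hv =>
    obtain ⟨p, -, rfl⟩ := hv
    rw [← inner_polyClass_of_mem_diracGraph μ hxy, inner_zero_right]
  | zero => exact inner_zero_left _
  | add v w _ _ h1 h2 => rw [inner_add_left, h1, h2, add_zero]

lemma isClosed_dirac : (dirac μ).IsClosed := by
  rw [LinearPMap.IsClosed, graph_dirac]
  have : (diracGraph μ : Set (SpinorL2 μ × SpinorL2 μ)) =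
      ⋂ (φ : SU2 → Spin) (a : SpinorL2 μ) (b : SpinorL2 μ) (_ : IsSmoothField φ)
        (_ : a =ᵐ[μ] φ) (_ : b =ᵐ[μ] diracSmooth φ), {p | ⟪b, p.1⟫_ℂ = ⟪a, p.2⟫_ℂ} := by
    ext p
    simp only [Set.mem_iInter]
    rfl
  rw [this]
  repeat refine isClosed_iInter fun _ => ?_
  exact isClosed_eq (by fun_prop) (by fun_prop)

lemma polySpin_eq_polyDirac_sub (p : Fin 2 → EntryPoly) :
    polySpin p = polyDirac p - (3 / 2 : ℂ) • p := by
  simp [polyDirac]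

lemma inner_polySpin (p q : Fin 2 → EntryPoly) :
    ⟪polyClass μ (polySpin p), polyClass μ q⟫_ℂ = ⟪polyClass μ p, polyClass μ (polySpin q)⟫_ℂ := by
  simp only [polySpin_eq_polyDirac_sub, map_sub, map_smul, inner_sub_left, inner_sub_right,
    inner_smul_left, inner_smul_right,
    inner_polyClass_of_mem_diracGraph μ (polyClass_mem_diracGraph μ q) p]
  simp [Complex.conj_ofNat]

lemma inner_invDer_invDer (j : Fin 3) (p : Fin 2 → EntryPoly) :
    ⟪polyClass μ p, polyClass μ (fun k => invDer j (invDer j (p k)))⟫_ℂ =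
      -(‖polyClass μ (fun k => invDer j (p k))‖ ^ 2 : ℝ) := by
  have h := (hasLeftInvDeriv_polyField j p).integral_inner μ
    (hasLeftInvDeriv_polyField j fun k => invDer j (p k))
  rw [← inner_eq_integral μ (coeFn_polyClass μ _) (coeFn_polyClass μ _),
    ← inner_eq_integral μ (coeFn_polyClass μ _) (coeFn_polyClass μ _)] at h
  rw [← neg_eq_iff_eq_neg.mpr h, inner_self_eq_norm_sq_to_K]
  push_cast
  rfl

/-- The eigenvalues of the Dirac operator on polynomial fields are at distance at least `1` from
`1 / 2`. -/
lemma eigenvalue_bound {p : Fin 2 → EntryPoly} {r : ℝ}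
    (h : polyClass μ (polyDirac p) = (r : ℂ) • polyClass μ p) (h0 : polyClass μ p ≠ 0) :
    1 / 2 ≤ |r| := by
  set a := polyClass μ p with ha
  have hT : polyClass μ (polySpin p) = ((r - 3 / 2 : ℝ) : ℂ) • a := by
    rw [polySpin_eq_polyDirac_sub, map_sub, map_smul, h, ← ha, ← sub_smul]
    push_cast
    rfl
  have key : polySpin (polySpin p) + (2 : ℂ) • polySpin p =
      -∑ j, fun k => invDer j (invDer j (p k)) := by
    funext k
    have := polySpin_polySpin p k
    simpa using this
  have e1 : ⟪a, a⟫_ℂ = ((‖a‖ ^ 2 : ℝ) : ℂ) := by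
    rw [inner_self_eq_norm_sq_to_K]
    push_cast
    rfl
  -- The eigenvalue equation holds between `L²` classes, not between polynomials, so one factor of
  -- `polySpin` is moved across by symmetry.
  have e2 : ⟪a, polyClass μ (polySpin (polySpin p))⟫_ℂ =
      (((r - 3 / 2) ^ 2 * ‖a‖ ^ 2 : ℝ) : ℂ) := by
    rw [ha, ← inner_polySpin, ← ha, hT, inner_smul_left, inner_smul_right, e1,
      Complex.conj_ofReal]
    push_cast
    ring
  have e3 : ⟪a, polyClass μ (polySpin p)⟫_ℂ = (((r - 3 / 2) * ‖a‖ ^ 2 : ℝ) : ℂ) := by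
    rw [hT, inner_smul_right, e1, Complex.ofReal_mul]
  have h1 := congrArg (fun q => ⟪a, polyClass μ q⟫_ℂ) key
  simp only [map_add, map_smul, map_neg, map_sum, inner_add_right, inner_smul_right,
    inner_neg_right, inner_sum, e2, e3] at h1
  simp only [ha, inner_invDer_invDer, Finset.sum_neg_distrib, neg_neg] at h1
  rw [← ha] at h1
  have hpos : 0 < ‖a‖ ^ 2 := pow_pos (norm_pos_iff.mpr h0) 2
  generalize ‖a‖ ^ 2 = N at h1 hpos
  have h2 : (r - 3 / 2) ^ 2 * N + 2 * ((r - 3 / 2) * N) =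
      ∑ j, ‖polyClass μ (fun k => invDer j (p k))‖ ^ 2 := by
    exact_mod_cast h1
  have h3 : 0 ≤ (r - 3 / 2) ^ 2 * N + 2 * ((r - 3 / 2) * N) := by
    rw [h2]
    exact Finset.sum_nonneg fun j _ => sq_nonneg _
  -- This says `(r - 1/2)² ≥ 1`, that is, `r ≤ -1/2` or `r ≥ 3/2`.
  have h4 : 0 ≤ (r - 3 / 2) ^ 2 + 2 * (r - 3 / 2) := by
    by_contra! hneg
    nlinarith [mul_neg_of_neg_of_pos hneg hpos]
  by_contra! hr
  obtain ⟨hr1, hr2⟩ := abs_lt.mp hr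
  nlinarith

theorem isExhaustedBy_dirac : IsExhaustedBy (dirac μ) (polyL2 μ) (1 / 2) where
  mono := polyL2_mono μ
  finite n := by
    exact Module.Finite.of_fg ((fg_polySpinors n).map _)
  dense := dense_polyL2 μ
  maps n w hw := by
    obtain ⟨p, hp, rfl⟩ := hw
    exact ⟨_, ⟨_, polyDirac_mem n hp, rfl⟩, by
      rw [graph_dirac]; exact polyClass_mem_diracGraph μ p⟩
  closed := isClosed_dirac μ
  symm x y hxy n w v hw hwv := by
    obtain ⟨p, hp, rfl⟩ := hw
    have h1 := polyClass_mem_diracGraph μ p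
    rw [← graph_dirac] at h1
    rw [graph_right_unique _ hwv h1]
    rw [graph_dirac] at hxy
    exact inner_polyClass_of_mem_diracGraph μ hxy p
  gap_pos := by norm_num
  gap n w r hw hwv h0 := by
    obtain ⟨p, hp, rfl⟩ := hw
    have h1 := polyClass_mem_diracGraph μ p
    rw [← graph_dirac] at h1
    exact eigenvalue_bound μ (graph_right_unique _ h1 hwv) h0

end SpinorSphere

namespace SpinorSphere

/-! ### The adjoint action on the Pauli matrices -/

/-- The coefficients of `g⁻¹ σ_j g` with respect to the Pauli matrices. -/
noncomputable def adjCoeff (g : SU2) (j l : Fin 3) : ℝ :=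
  ((star g.1 * pauli j * g.1 * pauli l).trace / 2).re

lemma trace_pauli (j : Fin 3) : (pauli j).trace = 0 := by
  fin_cases j <;> simp [pauli, Matrix.trace_fin_two]

/-- The Pauli matrices are a real basis of the traceless Hermitian matrices, orthogonal for the
trace form with squared length `2`. -/
lemma eq_sum_pauli {M : Matrix (Fin 2) (Fin 2) ℂ} (h : star M = M) (h0 : M.trace = 0) :
    M = ∑ l, ((((M * pauli l).trace / 2).re : ℝ) : ℂ) • pauli l := by
  have e := fun a b => congrFun (congrFun h a) b
  simp only [Matrix.star_apply] at e
  have e00 := e 0 0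
  have e01 := e 0 1
  have e10 := e 1 0
  rw [Matrix.trace_fin_two] at h0
  have h11 : M 1 1 = -M 0 0 := by linear_combination h0
  have r1 : (M 1 0).re = (M 0 1).re := by simpa using congrArg Complex.re e01
  have r2 : -(M 1 0).im = (M 0 1).im := by simpa using congrArg Complex.im e01
  have r3 : -(M 0 0).im = (M 0 0).im := by simpa using congrArg Complex.im e00
  ext a b
  fin_cases a <;> fin_cases b <;> apply Complex.ext <;>
    simp [pauli, Fin.sum_univ_three, Matrix.trace_fin_two, Matrix.mul_apply, h11] <;> linarith

lemma star_mul_pauli_mul (g : SU2) (j : Fin 3) :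
    star g.1 * pauli j * g.1 = ∑ l, (adjCoeff g j l : ℂ) • pauli l := by
  refine eq_sum_pauli ?_ ?_
  · simp only [star_mul, star_star, star_pauli, mul_assoc]
  · rw [Matrix.trace_mul_comm, ← mul_assoc, show g.1 * star g.1 = 1 from g.2.1.2, one_mul,
      trace_pauli]

/-- By cyclicity of the trace, the transposed coefficients describe conjugation by `g` in place of
`g⁻¹`. -/
lemma sum_adjCoeff_smul_pauli (g : SU2) (l : Fin 3) :
    ∑ j, (adjCoeff g j l : ℂ) • pauli j = g.1 * pauli l * star g.1 := by
  rw [eq_sum_pauli (M := g.1 * pauli l * star g.1)]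
  · refine Finset.sum_congr rfl fun j _ => ?_
    rw [adjCoeff, mul_assoc, mul_assoc, Matrix.trace_mul_comm, mul_assoc, Matrix.trace_mul_comm,
      mul_assoc g.1]
  · simp only [star_mul, star_star, star_pauli, mul_assoc]
  · rw [Matrix.trace_mul_comm, ← mul_assoc, show star g.1 * g.1 = 1 from g.2.1.1, one_mul,
      trace_pauli]

/-! ### The representation and the Dirac operator -/

/-- The action of `SU(2) × SU(2)` on spinor fields. -/
noncomputable def actField (g : SU2 × SU2) (φ : SU2 → Spin) (h : SU2) : Spin :=
  mat g.2.1 (φ (g.1⁻¹ * h * g.2))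

lemma IsSmoothField.actField {φ : SU2 → Spin} (hφ : IsSmoothField φ) (g : SU2 × SU2) :
    IsSmoothField (actField g φ) := by
  obtain ⟨Φ, hΦ, hφ⟩ := hφ
  refine ⟨fun A => mat g.2.1 (Φ fun a b => ∑ d, (∑ c, (g.1⁻¹).1 a c * A c d) * g.2.1 d b),
    ?_, fun h => ?_⟩
  · exact ((mat g.2.1).restrictScalars ℝ).contDiff.comp (hΦ.comp (by fun_prop))
  · rw [SpinorSphere.actField, hφ]
    congr 2

/-- The conjugated subgroup has velocity `u⁻¹(-iσ_j)u`, a real combination of the `-iσ_l`; the chain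
rule does the rest. -/
lemma hasDerivAt_smoothField {Φ : (Fin 2 → Fin 2 → ℂ) → Spin} (hΦ : ContDiff ℝ ∞ Φ)
    (k u : SU2) (j : Fin 3) :
    HasDerivAt (fun t : ℝ => Φ (entries (k * (u⁻¹ * expPauli j t * u))))
      (∑ l, (adjCoeff u j l) • fderiv ℝ Φ (entries k) (invField l k)) 0 := by
  have h1 : HasDerivAt (fun t : ℝ => entries (k * (u⁻¹ * expPauli j t * u)))
      (∑ l, (adjCoeff u j l) • invField l k) 0 := by
    refine hasDerivAt_pi.mpr fun a => hasDerivAt_pi.mpr fun b => ?_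
    have h2 : HasDerivAt (fun t : ℝ => ∑ d, (∑ c, (k.1 * (u⁻¹).1) a c * (expPauli j t).1 c d) *
        u.1 d b) (∑ d, (∑ c, (k.1 * (u⁻¹).1) a c * (-Complex.I * pauli j c d)) * u.1 d b) 0 :=
      HasDerivAt.fun_sum fun d _ => (HasDerivAt.fun_sum fun c _ =>
        (hasDerivAt_expPauli j c d).const_mul _).mul_const _
    have h3 : ∀ M : Matrix (Fin 2) (Fin 2) ℂ,
        ∑ d, (∑ c, (k.1 * (u⁻¹).1) a c * M c d) * u.1 d b =
          (k.1 * (star u.1 * M * u.1)) a b := by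
      intro M
      rw [show k.1 * (star u.1 * M * u.1) = k.1 * star u.1 * M * u.1 by simp only [mul_assoc]]
      rfl
    refine (h2.congr_deriv ?_).congr_of_eventuallyEq (.of_forall fun t => ?_)
    · rw [h3 fun c d => -Complex.I * pauli j c d,
        show (fun c d => -Complex.I * pauli j c d) = -Complex.I • pauli j from rfl,
        Matrix.mul_smul, Matrix.smul_mul, star_mul_pauli_mul]
      simp only [Matrix.mul_smul, Matrix.mul_sum, Finset.smul_sum, Matrix.sum_apply,
        Finset.sum_apply, Pi.smul_apply, invField, Matrix.smul_apply, smul_eq_mul,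
        Complex.real_smul]
      exact Finset.sum_congr rfl fun l _ => by ring
    · exact (h3 _).symm
  have h0 : k * (u⁻¹ * expPauli j 0 * u) = k := by simp [expPauli_zero]
  have h2 : HasFDerivAt Φ (fderiv ℝ Φ (entries (k * (u⁻¹ * expPauli j 0 * u))))
      (entries (k * (u⁻¹ * expPauli j 0 * u))) :=
    (hΦ.differentiable (by simp) _).hasFDerivAt
  have := h2.comp_hasDerivAt (0 : ℝ) h1
  rw [h0] at this
  simp only [map_sum, map_smul] at this
  exact this

lemma leftInvDeriv_actField {φ : SU2 → Spin} (hφ : IsSmoothField φ) (g : SU2 × SU2) (j : Fin 3)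
    (h : SU2) : leftInvDeriv j (actField g φ) h =
      mat g.2.1 (∑ l, (adjCoeff g.2 j l : ℂ) • leftInvDeriv l φ (g.1⁻¹ * h * g.2)) := by
  obtain ⟨Φ, hΦ, hφ⟩ := hφ
  obtain rfl : φ = fun g => Φ (entries g) := funext hφ
  have h1 := hasDerivAt_smoothField hΦ (g.1⁻¹ * h * g.2) g.2 j
  have h2 := ((mat g.2.1).restrictScalars ℝ).hasFDerivAt.comp_hasDerivAt (0 : ℝ) h1
  have h3 : (fun t : ℝ => actField g (fun g => Φ (entries g)) (h * expPauli j t)) =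
      ((mat g.2.1).restrictScalars ℝ) ∘
        fun t => Φ (entries (g.1⁻¹ * h * g.2 * (g.2⁻¹ * expPauli j t * g.2))) := by
    funext t
    simp [actField, mul_assoc]
  rw [leftInvDeriv, h3, h2.deriv]
  simp only [fun l => (hasLeftInvDeriv_of_contDiff l hΦ).leftInvDeriv_eq]
  rfl

/-- Right translation rotates the `X_j` and the spin action rotates the `σ_j`. The rotations cancel,
since `∑ j` of the rotated `σ_j` times `g₂` is `g₂ σ_l g₂* g₂ = g₂ σ_l`. -/
lemma diracSmooth_actField {φ : SU2 → Spin} (hφ : IsSmoothField φ) (g : SU2 × SU2) :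
    diracSmooth (actField g φ) = actField g (diracSmooth φ) := by
  funext h
  rw [diracSmooth, actField, actField, diracSmooth]
  simp only [leftInvDeriv_actField hφ, map_add, map_sum, map_smul]
  congr 1
  simp only [Finset.smul_sum]
  rw [Finset.sum_comm]
  refine Finset.sum_congr rfl fun l _ => ?_
  have key := congrArg (fun M => mat (M * g.2.1) (leftInvDeriv l φ (g.1⁻¹ * h * g.2)))
    (sum_adjCoeff_smul_pauli g.2 l)
  simp only [mul_assoc _ (star g.2.1), show star g.2.1 * g.2.1 = 1 from g.2.2.1.1, mul_one,
    map_mul, map_sum, map_smul, Finset.sum_mul, sum_apply, smul_mul_assoc, smul_apply, mul_apply_eq_comp] at key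
  refine Eq.trans ?_ (congrArg (Complex.I • ·) key)
  rw [Finset.smul_sum]

variable (μ : Measure SU2) [μ.IsHaarMeasure]

lemma coeFn_rho (g : SU2 × SU2) (ψ : SpinorL2 μ) {φ : SU2 → Spin} (h : ψ =ᵐ[μ] φ) :
    rho μ g ψ =ᵐ[μ] actField g φ := by
  have h2 := (measurePreserving_action μ g).quasiMeasurePreserving.ae h
  filter_upwards [coeFn_rhoMap μ g ψ, h2] with x h3 h4
  refine h3.trans ?_
  rw [h4, actField]

/-- By unitarity the action moves to the test field as `ρ(g⁻¹)`, which keeps it smooth and commutes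
with the differential operator. -/
lemma rho_mem_graph (g : SU2 × SU2) (x y : SpinorL2 μ) (hxy : (x, y) ∈ (dirac μ).graph) :
    (rho μ g x, rho μ g y) ∈ (dirac μ).graph := by
  rw [graph_dirac] at hxy ⊢
  intro φ a b hφ ha hb
  have h1 := coeFn_rho μ g⁻¹ b hb
  rw [← diracSmooth_actField hφ] at h1
  have h2 := hxy _ _ _ (hφ.actField g⁻¹) (coeFn_rho μ g⁻¹ a ha) h1
  have h3 : ∀ z, rho μ g (rho μ g⁻¹ z) = z := fun z => by
    rw [map_inv]
    exact (rho μ g).apply_symm_apply z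
  have h4 := (rho μ g).inner_map_map (rho μ g⁻¹ b) x
  have h5 := (rho μ g).inner_map_map (rho μ g⁻¹ a) y
  rw [h3] at h4 h5
  change ⟪b, rho μ g x⟫_ℂ = ⟪a, rho μ g y⟫_ℂ
  rw [h4, h5]
  exact h2

/-- The matrix factor varies continuously in operator norm and the translate continuously in `L²`;
applying one to the other is a bounded bilinear map. -/
lemma continuous_rho (ψ : SpinorL2 μ) : Continuous fun g : SU2 × SU2 => rho μ g ψ := by
  have hB : IsBoundedBilinearMap ℂ
      (fun q : (Spin →L[ℂ] Spin) × SpinorL2 μ => q.1.compLp q.2) :=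
    { add_left := fun L L' f => ContinuousLinearMap.add_compLp L L' f
      smul_left := fun c L f => ContinuousLinearMap.smul_compLp c L f
      add_right := fun L f f' => (L.compLpₗ 2 μ).map_add f f'
      smul_right := fun c L f => (L.compLpₗ 2 μ).map_smul c f
      bound := ⟨1, one_pos, fun L f => by rw [one_mul]; exact L.norm_compLp_le f⟩ }
  have hm : Continuous fun g : SU2 × SU2 => mat g.2.1 := by
    have : Continuous fun M : Matrix (Fin 2) (Fin 2) ℂ => mat M :=
      LinearMap.continuous_of_finiteDimensional
        ((Matrix.toEuclideanCLM (n := Fin 2) (𝕜 := ℂ)).toAlgEquiv.toLinearMap)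
    exact this.comp (continuous_subtype_val.comp continuous_snd)
  have hc : Continuous fun g : SU2 × SU2 =>
      Lp.compMeasurePreserving (fun h : SU2 => g.1⁻¹ * h * g.2)
        (measurePreserving_action μ g) ψ := by
    let f : SU2 × SU2 → C(SU2, SU2) := fun g => ⟨fun h => g.1⁻¹ * h * g.2, by fun_prop⟩
    have hf : Continuous f := ContinuousMap.continuous_of_continuous_uncurry _ (by
      change Continuous fun q : (SU2 × SU2) × SU2 => q.1.1⁻¹ * q.2 * q.1.2
      fun_prop)
    exact Continuous.compMeasurePreservingLp (g := fun g => (f g : C(SU2, SU2)))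
      (continuous_const (y := ψ)) hf (fun g => measurePreserving_action μ g) (by simp)
  exact hB.continuous.comp (hm.prodMk hc)

/-! ### Charge conjugation -/

/-- The charge conjugation of spinors. -/
noncomputable def conjEps : Spin →L⋆[ℂ] Spin := (mat !![0, 1; -1, 0]).comp conjSpin

lemma conjEps_apply (v : Spin) : conjEps v = !₂[conj (v 1), -conj (v 0)] := by
  ext k
  change ∑ l, !![(0 : ℂ), 1; -1, 0] k l * conj (v l) = _
  fin_cases k <;> simp

lemma conjEps_conjEps (v : Spin) : conjEps (conjEps v) = -v := by
  simp only [conjEps_apply]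
  ext k
  fin_cases k <;> simp

lemma inner_conjEps (v w : Spin) : ⟪conjEps v, conjEps w⟫_ℂ = conj ⟪v, w⟫_ℂ := by
  simp only [conjEps_apply, PiLp.inner_apply, Fin.sum_univ_two]
  simp
  ring

lemma mat_conjEps (g : SU2) (v : Spin) : mat g.1 (conjEps v) = conjEps (mat g.1 v) := by
  obtain ⟨h1, h2, h3, h4⟩ := conj_entries g
  rw [conjEps_apply, conjEps_apply]
  ext k
  simp only [mat_apply, Fin.sum_univ_two]
  fin_cases k <;> simp [h1, h2, h3, h4]
  ring

/-- The factor `i` is essential: `σ_j` alone anticommutes with the antilinear `conjEps`. -/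
lemma smul_pauli_conjEps (j : Fin 3) (v : Spin) :
    Complex.I • mat (pauli j) (conjEps v) = conjEps (Complex.I • mat (pauli j) v) := by
  rw [conjEps_apply, conjEps_apply]
  ext k
  simp only [PiLp.smul_apply, mat_apply, Fin.sum_univ_two]
  fin_cases j <;> fin_cases k <;> simp [pauli]

/-- Charge conjugation as a real-linear map. -/
noncomputable def conjEpsReal : Spin →L[ℝ] Spin :=
  ((conjEps : Spin →ₛₗ[starRingEnd ℂ] Spin) : Spin →+ Spin).toRealLinearMap conjEps.continuous

lemma IsSmoothField.conjEps {φ : SU2 → Spin} (hφ : IsSmoothField φ) :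
    IsSmoothField fun g => conjEps (φ g) := by
  obtain ⟨Φ, hΦ, hφ⟩ := hφ
  exact ⟨fun A => conjEpsReal (Φ A), conjEpsReal.contDiff.comp hΦ, fun g =>
    congrArg conjEpsReal (hφ g)⟩

lemma diracSmooth_conjEps {φ : SU2 → Spin} (hφ : IsSmoothField φ) :
    diracSmooth (fun g => conjEps (φ g)) = fun g => conjEps (diracSmooth φ g) := by
  funext g
  have h : ∀ j, leftInvDeriv j (fun g => conjEps (φ g)) = fun g => conjEps (leftInvDeriv j φ g) :=
    fun j => ((hφ.hasLeftInvDeriv j).comp_clm conjEpsReal).leftInvDeriv_eq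
  simp only [diracSmooth, h, smul_pauli_conjEps, map_add, map_sum, map_smulₛₗ conjEps (3 / 2 : ℂ)]
  simp [Complex.conj_ofNat]

omit [μ.IsHaarMeasure] in
lemma coeFn_chargeConj (ψ : SpinorL2 μ) {φ : SU2 → Spin} (h : ψ =ᵐ[μ] φ) :
    chargeConj μ ψ =ᵐ[μ] fun g => conjEps (φ g) := by
  filter_upwards [conjEps.coeFn_compLp ψ, h] with g h1 h2
  rw [← h2]
  exact h1

omit [μ.IsHaarMeasure] in
lemma chargeConj_chargeConj (ψ : SpinorL2 μ) : chargeConj μ (chargeConj μ ψ) = -ψ := by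
  refine Lp.ext ?_
  filter_upwards [coeFn_chargeConj μ _ (coeFn_chargeConj μ ψ (ae_eq_refl _)),
    Lp.coeFn_neg ψ] with g h1 h2
  rw [h1, h2, conjEps_conjEps, Pi.neg_apply]

omit [μ.IsHaarMeasure] in
lemma inner_chargeConj (ψ χ : SpinorL2 μ) :
    ⟪chargeConj μ ψ, chargeConj μ χ⟫_ℂ = conj ⟪ψ, χ⟫_ℂ := by
  rw [inner_eq_integral μ (coeFn_chargeConj μ ψ (ae_eq_refl _))
    (coeFn_chargeConj μ χ (ae_eq_refl _)),
    inner_eq_integral μ (ae_eq_refl ψ) (ae_eq_refl χ), ← integral_conj]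
  simp only [inner_conjEps]

omit [μ.IsHaarMeasure] in
lemma norm_chargeConj (ψ : SpinorL2 μ) : ‖chargeConj μ ψ‖ = ‖ψ‖ := by
  rw [@norm_eq_sqrt_re_inner ℂ, @norm_eq_sqrt_re_inner ℂ, inner_chargeConj, RCLike.conj_re]

/-- Antiunitarity and `C² = -1` give `⟪b, C x⟫ = -conj ⟪C b, x⟫`, so `C` moves to the test field. -/
lemma chargeConj_mem_graph (x y : SpinorL2 μ) (hxy : (x, y) ∈ (dirac μ).graph) :
    (chargeConj μ x, chargeConj μ y) ∈ (dirac μ).graph := by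
  rw [graph_dirac] at hxy ⊢
  intro φ a b hφ ha hb
  have h1 := coeFn_chargeConj μ b hb
  rw [← diracSmooth_conjEps hφ] at h1
  have h2 := hxy _ _ _ hφ.conjEps (coeFn_chargeConj μ a ha) h1
  have h4 := inner_chargeConj μ (chargeConj μ b) x
  have h5 := inner_chargeConj μ (chargeConj μ a) y
  rw [chargeConj_chargeConj, inner_neg_left, neg_eq_iff_eq_neg] at h4 h5
  change ⟪b, chargeConj μ x⟫_ℂ = ⟪a, chargeConj μ y⟫_ℂ
  rw [h4, h5]
  exact congrArg (fun z => -conj z) h2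

lemma rho_chargeConj (g : SU2 × SU2) (ψ : SpinorL2 μ) :
    rho μ g (chargeConj μ ψ) = chargeConj μ (rho μ g ψ) := by
  refine Lp.ext ?_
  filter_upwards [coeFn_rho μ g _ (coeFn_chargeConj μ ψ (ae_eq_refl _)),
    coeFn_chargeConj μ _ (coeFn_rho μ g ψ (ae_eq_refl _))] with h h1 h2
  rw [h1, h2, actField, actField, mat_conjEps]

lemma rho_signOp (g : SU2 × SU2) (ψ : SpinorL2 μ) :
    rho μ g (signOp (dirac μ) ψ) = signOp (dirac μ) (rho μ g ψ) :=
  ((isExhaustedBy_dirac μ).signOp_comm ((rho μ g).toLinearEquiv.toLinearMap : _ →+ _)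
    (rho μ g).continuous (fun c x => ⟨c, (rho μ g).map_smul c x⟩)
    (fun r x => (rho μ g).map_smul (r : ℂ) x) (rho_mem_graph μ g) ψ).symm

end SpinorSphere

theorem theorem1 (μ : MeasureTheory.Measure SU2) [μ.IsHaarMeasure] :
    -- the Dirac operator is self-adjoint with trivial kernel, and `signOp` is its sign
    IsSelfAdjoint (dirac μ) ∧
    (∀ x : (dirac μ).domain, dirac μ x = 0 → (x : SpinorL2 μ) = 0) ∧
    IsPolarSign (dirac μ) (signOp (dirac μ)) ∧
    -- the representation `ρ` is strongly continuous and commutes with the Dirac operator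
    (∀ ψ : SpinorL2 μ, Continuous fun g : SU2 × SU2 => rho μ g ψ) ∧
    (∀ g : SU2 × SU2, CommutesWith ((rho μ g : SpinorL2 μ ≃L[ℂ] SpinorL2 μ) :
      SpinorL2 μ →L[ℂ] SpinorL2 μ) (dirac μ)) ∧
    -- `j = i 𝐝/|𝐝|` is a complex structure; `ρ`, `𝐝` and `|𝐝|` commute with it
    ∃ (hJ : IsComplexStructure (newJ μ))
      (hρ : ∀ (g : SU2 × SU2) (ψ : SpinorL2 μ), rho μ g (newJ μ ψ) = newJ μ (rho μ g ψ))
      (hd : CommutesWith (newJ μ) (dirac μ))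
      (ha : CommutesWith (newJ μ) (absOp (dirac μ))),
      -- on the new Hilbert space, `𝐝` is self-adjoint and `|𝐝|` is self-adjoint and positive
      IsSelfAdjoint (hJ.op (dirac μ) hd) ∧
      IsSelfAdjoint (hJ.op (absOp (dirac μ)) ha) ∧
      (∀ x : (hJ.op (absOp (dirac μ)) ha).domain, (x : hJ.Space) ≠ 0 →
        0 < (inner ℂ (x : hJ.Space) (hJ.op (absOp (dirac μ)) ha x)).re) ∧
      -- `F` is a unitary operator
      ∃ U : SpinorL2 μ ≃ₗᵢ[ℂ] hJ.Space,
        (∀ ψ : SpinorL2 μ, U ψ = mapF μ hJ ψ) ∧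
        -- `F` intertwines `ρ` and the representation induced by `ρ` on the new Hilbert space
        (∀ (g : SU2 × SU2) (ψ : SpinorL2 μ), U (rho μ g ψ) = hJ.rep (rho μ) hρ g (U ψ)) ∧
        -- `F` maps the domain of `𝐝` onto the domain of `𝐝`, and `F 𝐝 = 𝐝 F` there
        (∀ ψ : SpinorL2 μ, ψ ∈ (dirac μ).domain ↔ U ψ ∈ (hJ.op (dirac μ) hd).domain) ∧
        (∀ (x : (dirac μ).domain) (y : (hJ.op (dirac μ) hd).domain),
          (y : hJ.Space) = U x → U (dirac μ x) = hJ.op (dirac μ) hd y) := by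
  have h := isExhaustedBy_dirac μ
  have hJ : IsComplexStructure (newJ μ) := h.isComplexStructure
  have hd : CommutesWith (newJ μ) (dirac μ) := h.commutesWith_smul_signOp
  have ha : CommutesWith (newJ μ) (absOp (dirac μ)) := h.commutesWith_smul_signOp_absOp
  have hρ : ∀ (g : SU2 × SU2) (ψ : SpinorL2 μ), rho μ g (newJ μ ψ) = newJ μ (rho μ g ψ) := by
    intro g ψ
    simp only [newJ, smul_apply, map_smul, rho_signOp]
  refine ⟨h.isSelfAdjoint, h.eq_zero_of_apply_eq_zero, h.isPolarSign, continuous_rho μ,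
    fun g => (commutesWith_iff_graph _ _).mpr (rho_mem_graph μ g), hJ, hρ, hd, ha,
    hJ.isSelfAdjoint_op h.isSelfAdjoint hd, hJ.isSelfAdjoint_op h.isPolarSign.abs_isSelfAdjoint ha,
    -- The real part of the inner product is the same in both complex structures.
    fun x hx => h.isPolarSign.abs_pos ⟨hJ.I.symm x, x.2⟩ hx, ?_⟩
  obtain ⟨U, hU, hUT, hUg⟩ := h.exists_unitary (chargeConj μ) (chargeConj_chargeConj μ)
    (norm_chargeConj μ) (chargeConj_mem_graph μ) hJ rfl hd
  refine ⟨U, hU, fun g ψ => ?_, fun ψ => ⟨fun hψ => ?_, fun hψ => ?_⟩, fun x y hxy => ?_⟩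
  · exact hUT ((rho μ g).toLinearEquiv.toLinearMap : _ →+ _) (rho_chargeConj μ g) (rho_signOp μ g)
      (fun r x => (rho μ g).map_smul (r : ℂ) x) ψ
  · exact LinearPMap.mem_domain_of_mem_graph ((hUg _ _).mp (mem_graph_of_mem_domain _ hψ))
  -- Surjectivity writes the value at `U ψ` as `U z`, so the graph equivalence can be read
  -- backwards.
  · obtain ⟨z, hz⟩ := U.surjective (hJ.op (dirac μ) hd ⟨U ψ, hψ⟩)
    have := mem_graph_of_mem_domain _ hψ
    rw [← hz] at this
    exact LinearPMap.mem_domain_of_mem_graph ((hUg _ _).mpr this)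
  · have h1 := (hUg _ _).mp ((dirac μ).mem_graph x)
    rw [← hxy] at h1
    exact graph_right_unique _ h1 ((hJ.op (dirac μ) hd).mem_graph y)
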